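/- **Setting.** Let $n\ge 2$. Call $f:[0,1]^n\to\mathbb{R}_{\ge 0}$ *DR-submodular* if $f(x+\delta \mathbf 1_i)-f(x)\ge f(y+\delta\mathbf 1_i)-f(y)$ for all $x\le y$ in $[0,1]^n$, all $i\in[n]$ and all $\delta\in[0,1]$ with $x+\delta\mathbf 1_i,\,y+\delta\mathbf 1_i\in[0,1]^n$. Let $r:2^{[n]}\to\mathbb{R}_{\ge 0}$ be monotone, submodular and satisfy $r(\emptyset)=0$, and let $\mathbf P=\{x\ge 0:\ \sum_{i\in S}x_i\le r(S)\ \forall S\subseteq[n]\}$ be its polymatroid; if $r$ is the rank function of a matroid, $\mathbf P$ is the matroid polytope. The problem is to maximize $f$ over $\mathbf P\cap[0,1]^n$; let $x^*$ be an optimal solution. An algorithm (which knows $n$, $\varepsilon$ and $r$) accesses $f$ only through oracles for $f$ and $\nabla f$ on $[0,1]^n$. It works in adaptive rounds: in each round it submits finitely many query points, which depend only on the answers of earlier rounds, and receives the values of $f$ and $\nabla f$ at these points. The number of evaluations is the total number of query points over all rounds. **Theorem.** For every $c\in\mathbb{R}$ and $k\in\mathbb{N}$ there is a constant $C$ such that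 for every $n\ge 2$, every $\varepsilon>0$ and every $r$ as above there is a deterministic algorithm that, for every differentiable DR-submodular $f:[0,1]^n\to\mathbb{R}_{\ge0}$, stops and returns a point $z\in\mathbf P\cap[0,1]^n$ with - $f(z)\ge(1-1/e-\varepsilon)\,f(x^*)$ if $f$ is monotone, and $f(z)\ge(1/e-\varepsilon)\,f(x^*)$ in general; - if moreover $\nabla_i f(x)\le c\,(n/\varepsilon)^k f(x^*)$ for all $x\in[0,1]^n$ and $i\in[n]$, then both the number of adaptive rounds and the number of evaluations of $f$ and $\nabla f$ are at most $C\log^2 n/\varepsilon^3$. The gradient assumption holds when $f$ is the multilinear extension $f(x)=\sum_{S}g(S)\prod_{i\in S}x_i\prod_{i\notin S}(1-x_i)$ of a nonnegative submodular set function $g:2^{[n]}\to\mathbb{R}_{\ge 0}$ and $r(\{i\})\ge 1$ for all $i$ (for a matroid: there are no loops); in that case $\nabla_i f(x)\le f(x^*)$ for all $x\in[0,1]^n$ and $i\in[n]$. -/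

import Mathlib

namespace DRMax

/-- The unit cube `[0,1]^n`. -/
def cube (n : ℕ) : Set (Fin n → ℝ) := Set.Icc 0 1

/-- Diminishing returns submodularity on `[0,1]^n`. -/
def IsDRSubmodular {n : ℕ} (f : (Fin n → ℝ) → ℝ) : Prop :=
  ∀ x ∈ cube n, ∀ y ∈ cube n, x ≤ y → ∀ i : Fin n, ∀ δ ∈ Set.Icc (0 : ℝ) 1,
    x + Pi.single i δ ∈ cube n → y + Pi.single i δ ∈ cube n →
      f (y + Pi.single i δ) - f y ≤ f (x + Pi.single i δ) - f x

/-- Normalized, monotone, submodular set functions (such functions are nonnegative). -/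
structure IsPolymatroidRank {n : ℕ} (r : Finset (Fin n) → ℝ) : Prop where
  empty : r ∅ = 0
  mono : ∀ S T, S ⊆ T → r S ≤ r T
  submodular : ∀ S T, r (S ∪ T) + r (S ∩ T) ≤ r S + r T

/-- The polymatroid `{x ≥ 0 : x(S) ≤ r(S) for all S}`; if `r` is the rank function of a matroid,
this is the matroid polytope. -/
def polymatroid {n : ℕ} (r : Finset (Fin n) → ℝ) : Set (Fin n → ℝ) :=
  {x | 0 ≤ x ∧ ∀ S : Finset (Fin n), ∑ i ∈ S, x i ≤ r S}

/-- The rank function of a matroid is a polymatroid rank function. -/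
theorem isPolymatroidRank_matroid {n : ℕ} (M : Matroid (Fin n)) :
    IsPolymatroidRank (fun S : Finset (Fin n) => ((M.eRk (S : Set (Fin n))).toNat : ℝ)) := by
  have hfin : ∀ S : Finset (Fin n), M.eRk (S : Set (Fin n)) ≠ ⊤ := fun S =>
    ne_top_of_le_ne_top (Set.encard_ne_top_iff.2 S.finite_toSet)
      (M.eRk_le_encard (S : Set (Fin n)))
  refine ⟨by simp, fun S T h => ?_, fun S T => ?_⟩
  · exact_mod_cast ENat.toNat_le_toNat (M.eRk_mono (by exact_mod_cast h)) (hfin T)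
  · have h := M.eRk_inter_add_eRk_union_le (S : Set (Fin n)) (T : Set (Fin n))
    rw [← Finset.coe_inter, ← Finset.coe_union, ← ENat.natCast_toNat (hfin (S ∩ T)),
      ← ENat.natCast_toNat (hfin (S ∪ T)), ← ENat.natCast_toNat (hfin S), ← ENat.natCast_toNat (hfin T)] at h
    have h' : (M.eRk ((S ∩ T : Finset (Fin n)) : Set (Fin n))).toNat
        + (M.eRk ((S ∪ T : Finset (Fin n)) : Set (Fin n))).toNat
        ≤ (M.eRk (S : Set (Fin n))).toNat + (M.eRk (T : Set (Fin n))).toNat := by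
      exact_mod_cast h
    have h'' := (Nat.cast_le (α := ℝ)).2 h'
    rw [Nat.cast_add, Nat.cast_add] at h''
    linarith

/-- The feasible points: the points of the polymatroid that lie in the domain `[0,1]^n`. -/
def feasible {n : ℕ} (r : Finset (Fin n) → ℝ) : Set (Fin n → ℝ) := polymatroid r ∩ cube n

/-- The gradient of `f` on `[0,1]^n` (one-sided at boundary points). -/
noncomputable def grad {n : ℕ} (f : (Fin n → ℝ) → ℝ) (x : Fin n → ℝ) : Fin n → ℝ :=
  fun i => fderivWithin ℝ f (cube n) x (Pi.single i 1)

/-- Submodularity (diminishing returns) of a set function. -/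
def IsSubmodular {n : ℕ} (g : Finset (Fin n) → ℝ) : Prop :=
  ∀ A B : Finset (Fin n), A ⊆ B → ∀ v ∉ B, g (insert v B) - g B ≤ g (insert v A) - g A

/-- The multilinear extension of a set function. -/
def multilinearExt {n : ℕ} (g : Finset (Fin n) → ℝ) (x : Fin n → ℝ) : ℝ :=
  ∑ S : Finset (Fin n), g S * ((∏ i ∈ S, x i) * ∏ i ∈ Sᶜ, (1 - x i))

/-- A deterministic adaptive algorithm with oracle access to a function on `[0,1]^n` and its
gradient. It either stops with an output, or performs a round: it submits `m` points, all chosen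
before any answer of this round is seen, receives the value and the whole gradient at each of
them, and continues depending on the answers. As the type is inductive, every run is finite. -/
inductive Algorithm (n : ℕ) : Type
  | output (z : Fin n → ℝ) : Algorithm n
  | round (m : ℕ) (q : Fin m → cube n) (next : (Fin m → ℝ × (Fin n → ℝ)) → Algorithm n) :
      Algorithm n

/-- The answer of the oracles for `f` and its gradient at a point. -/
noncomputable def oracle {n : ℕ} (f : (Fin n → ℝ) → ℝ) (x : cube n) : ℝ × (Fin n → ℝ) :=
  (f x, grad f x)

namespace Algorithm

/-- The output of the algorithm on the input function `f`. -/
noncomputable def result {n : ℕ} (f : (Fin n → ℝ) → ℝ) : Algorithm n → (Fin n → ℝ)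
  | output z => z
  | round _ q next => result f (next fun j => oracle f (q j))

/-- The number of adaptive rounds on the input function `f`. -/
noncomputable def rounds {n : ℕ} (f : (Fin n → ℝ) → ℝ) : Algorithm n → ℕ
  | output _ => 0
  | round _ q next => rounds f (next fun j => oracle f (q j)) + 1

/-- The total number of points, over all rounds, at which `f` and its gradient are evaluated. -/
noncomputable def evaluations {n : ℕ} (f : (Fin n → ℝ) → ℝ) : Algorithm n → ℕ
  | output _ => 0
  | round m q next => evaluations f (next fun j => oracle f (q j)) + m

end Algorithm

end DRMax

namespace DRMax

open Filter Topology

variable {n : ℕ} {f : (Fin n → ℝ) → ℝ} {r : Finset (Fin n) → ℝ}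

/-! The algorithm is a measured continuous greedy method in N = 1/η phases with η ≤ ε/32. A phase
replaces x by x + η(1 - x)y, where y is a feasible direction built by decreasing thresholds. Each
round reads the gradient at one lookahead point lying above everything the round can reach; as
gradients are antitone (`grad_anti`), growth of a coordinate passing the threshold v earns at least
ηv per unit (`step_spec`). The caps double, so after logarithmically many rounds every coordinate
still passing v is saturated (`level_spec`). Saturated coordinates of y carry, in any feasible z, at
most the total mass of y (`sum_saturated_le`); hence y competes with the optimum (`direction_spec`).

Reading ahead costs little because f at the lookahead point is controlled by concavity
(`lookahead_value_le`). Joining the optimum with a point whose coordinates are at most m keeps a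
fraction 1 - m of its value (`mul_le_sup`), about (1 - η)^j after j phases. The resulting recurrence
discretises a' = exp(-t)·OPT - a, with value OPT/e at time 1; for monotone f nothing is lost in the
join, and a' = OPT - a gives 1 - 1/e.

Both the step τ and the number of thresholds rely on a bound G ≤ K·OPT for the gradient at 0. The
output x certifies it if G ≤ K·f(x), since f(x) ≤ OPT. Under the gradient assumption the certificate
always succeeds; otherwise an exhaustive search, whose cost need not be bounded, supplies the
approximation (`exhaustiveAlg_spec`). There are N·J·R + 2 rounds with one query each, where J is of
order N·log(n/ε) and R of order log(n/ε); one factor 1/ε absorbs the logarithms of 1/ε. -/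

theorem mem_cube_iff {x : Fin n → ℝ} : x ∈ cube n ↔ ∀ i, 0 ≤ x i ∧ x i ≤ 1 := by
  simp only [cube, Set.mem_Icc, Pi.le_def, Pi.zero_apply, Pi.one_apply, forall_and]

theorem zero_mem_cube : (0 : Fin n → ℝ) ∈ cube n := mem_cube_iff.2 fun _ => by simp

theorem convex_cube : Convex ℝ (cube n) := convex_Icc _ _

/-! ### First-order calculus of DR-submodular functions on the cube. -/

/-- The hypotheses on the objective: nonnegative, differentiable and DR-submodular. -/
structure IsObjective (f : (Fin n → ℝ) → ℝ) : Prop where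
  nonneg : ∀ x ∈ cube n, 0 ≤ f x
  diff : DifferentiableOn ℝ f (cube n)
  dr : IsDRSubmodular f

theorem fderivWithin_apply_eq_sum_grad (f : (Fin n → ℝ) → ℝ) (x d : Fin n → ℝ) :
    fderivWithin ℝ f (cube n) x d = ∑ i, d i * grad f x i := by
  have h : d = ∑ i, d i • (Pi.single i (1 : ℝ) : Fin n → ℝ) := by
    ext j
    simp [Finset.sum_apply, Pi.single_apply]
  conv_lhs => rw [h]
  simp [map_sum, grad]

theorem update_mem_cube {x : Fin n → ℝ} (hx : x ∈ cube n) (i : Fin n) {t : ℝ}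
    (ht : t ∈ Set.Icc (0 : ℝ) 1) : Function.update x i t ∈ cube n := by
  rw [mem_cube_iff] at hx ⊢
  intro j
  rcases eq_or_ne j i with rfl | h
  · simpa using ht
  · simpa [h] using hx j

theorem hasDerivWithinAt_update (hf : DifferentiableOn ℝ f (cube n)) {x : Fin n → ℝ}
    (hx : x ∈ cube n) (i : Fin n) :
    HasDerivWithinAt (fun t => f (Function.update x i t)) (grad f x i) (Set.Icc 0 1) (x i) := by
  have h1 : HasFDerivWithinAt f (fderivWithin ℝ f (cube n) x) (cube n)
      (Function.update x i (x i)) := by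
    rw [Function.update_eq_self]
    exact (hf x hx).hasFDerivWithinAt
  have h2 : HasDerivWithinAt (fun t : ℝ => Function.update x i t) (Pi.single i 1)
      (Set.Icc 0 1) (x i) := (hasDerivAt_update x i (x i)).hasDerivWithinAt
  exact h1.comp_hasDerivWithinAt (x i) h2 fun t ht => update_mem_cube hx i ht

theorem tendsto_slope_right {φ : ℝ → ℝ} {D a : ℝ} (h : HasDerivWithinAt φ D (Set.Icc 0 1) a)
    (h0 : 0 ≤ a) (h1 : a < 1) :
    Tendsto (fun δ => δ⁻¹ * (φ (a + δ) - φ a)) (𝓝[>] 0) (𝓝 D) := by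
  have hlim : Tendsto (fun δ => a + δ) (𝓝[>] 0) (𝓝[Set.Icc 0 1 \ {a}] a) := by
    refine tendsto_nhdsWithin_iff.2 ⟨?_, ?_⟩
    · exact (Continuous.tendsto' (by fun_prop) 0 a (by simp)).mono_left nhdsWithin_le_nhds
    · filter_upwards [Ioo_mem_nhdsGT (sub_pos.2 h1)] with δ hδ
      exact ⟨⟨by linarith [hδ.1], by linarith [hδ.2]⟩, by simp [hδ.1.ne']⟩
  refine ((hasDerivWithinAt_iff_tendsto_slope.1 h).comp hlim).congr fun δ => ?_
  simp [slope]

theorem tendsto_slope_left {φ : ℝ → ℝ} {D a : ℝ} (h : HasDerivWithinAt φ D (Set.Icc 0 1) a)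
    (h0 : 0 < a) (h1 : a ≤ 1) :
    Tendsto (fun δ => δ⁻¹ * (φ a - φ (a - δ))) (𝓝[>] 0) (𝓝 D) := by
  have hlim : Tendsto (fun δ => a - δ) (𝓝[>] 0) (𝓝[Set.Icc 0 1 \ {a}] a) := by
    refine tendsto_nhdsWithin_iff.2 ⟨?_, ?_⟩
    · exact (Continuous.tendsto' (by fun_prop) 0 a (by simp)).mono_left nhdsWithin_le_nhds
    · filter_upwards [Ioo_mem_nhdsGT h0] with δ hδ
      exact ⟨⟨by linarith [hδ.2], by linarith [hδ.1]⟩, by simp [hδ.1.ne']⟩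
  refine ((hasDerivWithinAt_iff_tendsto_slope.1 h).comp hlim).congr fun δ => ?_
  simp only [Function.comp, slope, vsub_eq_sub, smul_eq_mul, sub_sub_cancel_left, inv_neg]
  ring

/-- If the increments of `ψ` are at most the earlier increments of `φ`, then the derivatives are
ordered in the same way. -/
theorem deriv_le_of_increments_le {φ ψ : ℝ → ℝ} {a b D E : ℝ} (ha : 0 ≤ a) (hab : a ≤ b)
    (hb : b ≤ 1) (hφ : HasDerivWithinAt φ D (Set.Icc 0 1) a)
    (hψ : HasDerivWithinAt ψ E (Set.Icc 0 1) b)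
    (h : ∀ s t δ : ℝ, 0 ≤ s → s ≤ t → 0 ≤ δ → t + δ ≤ 1 → ψ (t + δ) - ψ t ≤ φ (s + δ) - φ s) :
    E ≤ D := by
  rcases hb.lt_or_eq with hb1 | rfl
  · refine le_of_tendsto_of_tendsto (tendsto_slope_right hψ (ha.trans hab) hb1)
      (tendsto_slope_right hφ ha (hab.trans_lt hb1)) ?_
    filter_upwards [Ioo_mem_nhdsGT (sub_pos.2 hb1)] with δ hδ
    exact mul_le_mul_of_nonneg_left (h a b δ ha hab hδ.1.le (by linarith [hδ.2]))
      (inv_nonneg.2 hδ.1.le)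
  -- At `b = 1` only backward quotients of `ψ` are available. If `a < 1` they are compared with
  -- forward quotients of `φ`, as `a ≤ 1 - δ` for small `δ`.
  · rcases hab.lt_or_eq with ha1 | rfl
    · refine le_of_tendsto_of_tendsto (tendsto_slope_left hψ one_pos le_rfl)
        (tendsto_slope_right hφ ha ha1) ?_
      filter_upwards [Ioo_mem_nhdsGT (sub_pos.2 ha1)] with δ hδ
      have := h a (1 - δ) δ ha (by linarith [hδ.2]) hδ.1.le (by linarith)
      rw [sub_add_cancel] at this
      exact mul_le_mul_of_nonneg_left this (inv_nonneg.2 hδ.1.le)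
    · refine le_of_tendsto_of_tendsto (tendsto_slope_left hψ one_pos le_rfl)
        (tendsto_slope_left hφ one_pos le_rfl) ?_
      filter_upwards [Ioo_mem_nhdsGT one_pos] with δ hδ
      have := h (1 - δ) (1 - δ) δ (by linarith [hδ.2]) le_rfl hδ.1.le (by linarith)
      rw [sub_add_cancel] at this
      exact mul_le_mul_of_nonneg_left this (inv_nonneg.2 hδ.1.le)

theorem update_add_single (x : Fin n → ℝ) (i : Fin n) (s δ : ℝ) :
    Function.update x i s + Pi.single i δ = Function.update x i (s + δ) := by
  ext j
  rcases eq_or_ne j i with rfl | h <;> simp [*]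

namespace IsObjective

/-- The gradient of a DR-submodular function is antitone. -/
theorem grad_anti (hf : IsObjective f) {x y : Fin n → ℝ} (hx : x ∈ cube n) (hy : y ∈ cube n)
    (hxy : x ≤ y) (i : Fin n) : grad f y i ≤ grad f x i := by
  refine deriv_le_of_increments_le (mem_cube_iff.1 hx i).1 (hxy i) (mem_cube_iff.1 hy i).2
    (hasDerivWithinAt_update hf.diff hx i) (hasDerivWithinAt_update hf.diff hy i) ?_
  intro s t δ hs hst hδ ht
  have := hf.dr _ (update_mem_cube hx i ⟨hs, by linarith⟩) _
    (update_mem_cube hy i (t := t) ⟨by linarith, by linarith⟩)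
    (update_le_update_iff.2 ⟨hst, fun j _ => hxy j⟩) i δ ⟨hδ, by linarith⟩
  simp only [update_add_single] at this
  exact this (update_mem_cube hx i ⟨by linarith, by linarith⟩)
    (update_mem_cube hy i ⟨by linarith, by linarith⟩)

theorem exists_mean_value (hf : IsObjective f) {x y : Fin n → ℝ} (hx : x ∈ cube n)
    (hy : y ∈ cube n) (hxy : x ≤ y) :
    ∃ w ∈ cube n, x ≤ w ∧ w ≤ y ∧ f y - f x = ∑ i, (y i - x i) * grad f w i := by
  have hmem : ∀ t ∈ Set.Icc (0 : ℝ) 1, x + t • (y - x) ∈ cube n := fun t ht =>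
    convex_cube.add_smul_sub_mem hx hy ht
  have hder : ∀ t ∈ Set.Icc (0 : ℝ) 1, HasDerivWithinAt (fun t : ℝ => f (x + t • (y - x)))
      (∑ i, (y i - x i) * grad f (x + t • (y - x)) i) (Set.Icc 0 1) t := by
    intro t ht
    have h1 := (hf.diff _ (hmem t ht)).hasFDerivWithinAt
    have h2 : HasDerivWithinAt (fun t : ℝ => x + t • (y - x)) (y - x) (Set.Icc 0 1) t := by
      simpa using (((hasDerivAt_id t).smul_const (y - x)).const_add x).hasDerivWithinAt
    have h3 := h1.comp_hasDerivWithinAt t h2 hmem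
    rw [fderivWithin_apply_eq_sum_grad] at h3
    exact h3
  obtain ⟨t, ht, h⟩ := exists_hasDerivAt_eq_slope (fun t : ℝ => f (x + t • (y - x)))
    (fun t => ∑ i, (y i - x i) * grad f (x + t • (y - x)) i) one_pos
    (fun t ht => (hder t ht).continuousWithinAt)
    (fun t ht => (hder t (Set.Ioo_subset_Icc_self ht)).hasDerivAt (Icc_mem_nhds ht.1 ht.2))
  refine ⟨_, hmem t (Set.Ioo_subset_Icc_self ht), ?_, ?_, ?_⟩
  · intro i
    have := mul_nonneg ht.1.le (sub_nonneg.2 (hxy i))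
    simpa using this
  · intro i
    have := mul_nonneg (sub_nonneg.2 ht.2.le) (sub_nonneg.2 (hxy i))
    simp only [Pi.add_apply, Pi.smul_apply, Pi.sub_apply, smul_eq_mul]
    linarith
  · simpa using h.symm

/-- A tangent inequality, valid only between comparable points: there the gradient at the mean value
point is dominated by the gradient at the lower end. `sum_grad_le_sub` uses the upper end instead.
-/
theorem sub_le_sum_grad (hf : IsObjective f) {x y : Fin n → ℝ} (hx : x ∈ cube n)
    (hy : y ∈ cube n) (hxy : x ≤ y) :
    f y - f x ≤ ∑ i, (y i - x i) * grad f x i := by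
  obtain ⟨w, hw, hxw, -, h⟩ := hf.exists_mean_value hx hy hxy
  rw [h]
  exact Finset.sum_le_sum fun i _ =>
    mul_le_mul_of_nonneg_left (hf.grad_anti hx hw hxw i) (sub_nonneg.2 (hxy i))

theorem sum_grad_le_sub (hf : IsObjective f) {x y : Fin n → ℝ} (hx : x ∈ cube n)
    (hy : y ∈ cube n) (hxy : x ≤ y) :
    ∑ i, (y i - x i) * grad f y i ≤ f y - f x := by
  obtain ⟨w, hw, -, hwy, h⟩ := hf.exists_mean_value hx hy hxy
  rw [h]
  exact Finset.sum_le_sum fun i _ =>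
    mul_le_mul_of_nonneg_left (hf.grad_anti hw hy hwy i) (sub_nonneg.2 (hxy i))

/-- Concavity along nonnegative directions, for a point and two multiples of a direction. -/
theorem concave_ray (hf : IsObjective f) {x d : Fin n → ℝ} (hd : 0 ≤ d) (hx : x ∈ cube n)
    {s t : ℝ} (hs : 0 ≤ s) (ht : 0 ≤ t) (hst : x + (s + t) • d ∈ cube n) :
    s * (f (x + (s + t) • d) - f (x + s • d)) ≤ t * (f (x + s • d) - f x) := by
  have hle1 : x ≤ x + s • d := le_add_of_nonneg_right (smul_nonneg hs hd)
  have hle2 : x + s • d ≤ x + (s + t) • d := by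
    rw [add_smul, ← add_assoc]
    exact le_add_of_nonneg_right (smul_nonneg ht hd)
  have hm : x + s • d ∈ cube n := ⟨hx.1.trans hle1, hle2.trans hst.2⟩
  -- Both increments are compared with the slope at the common middle point.
  have h1 := hf.sub_le_sum_grad hm hst hle2
  have h2 := hf.sum_grad_le_sub hx hm hle1
  have e1 : ∑ i, ((x + (s + t) • d) i - (x + s • d) i) * grad f (x + s • d) i
      = t * ∑ i, d i * grad f (x + s • d) i := by
    rw [Finset.mul_sum]
    refine Finset.sum_congr rfl fun i _ => ?_
    simp only [Pi.add_apply, Pi.smul_apply, smul_eq_mul]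
    ring
  have e2 : ∑ i, ((x + s • d) i - x i) * grad f (x + s • d) i
      = s * ∑ i, d i * grad f (x + s • d) i := by
    rw [Finset.mul_sum]
    refine Finset.sum_congr rfl fun i _ => ?_
    simp only [Pi.add_apply, Pi.smul_apply, smul_eq_mul]
    ring
  rw [e1] at h1
  rw [e2] at h2
  have h3 := mul_le_mul_of_nonneg_left h1 hs
  have h4 := mul_le_mul_of_nonneg_left h2 ht
  linarith

/-- Joining a point with coordinates at most `m` costs at most a factor `1 - m`. -/
theorem mul_le_sup (hf : IsObjective f) {x w : Fin n → ℝ} (hx : x ∈ cube n) {m : ℝ} (hm0 : 0 < m)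
    (hm1 : m ≤ 1) (hwm : ∀ i, w i ≤ m) : (1 - m) * f x ≤ f (w ⊔ x) := by
  have hx' := mem_cube_iff.1 hx
  -- The segment from `x` to `w ⊔ x` can be prolonged by the factor `m⁻¹` inside the cube, because
  -- `m - x i ≤ m * (1 - x i)`. Concavity and nonnegativity at the far end then give the bound.
  have hd : ∀ i, m⁻¹ * ((w ⊔ x) i - x i) ≤ 1 - x i := by
    intro i
    rw [inv_mul_le_iff₀ hm0]
    have h1 := hwm i
    have h2 := hx' i
    rcases le_total (w i) (x i) with h | h
    · simp only [Pi.sup_apply, sup_eq_right.2 h, sub_self]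
      exact mul_nonneg hm0.le (by linarith)
    · simp only [Pi.sup_apply, sup_eq_left.2 h]
      nlinarith
  have hd0 : 0 ≤ w ⊔ x - x := sub_nonneg.2 le_sup_right
  have hm' : (m⁻¹ - 1) ≥ 0 := by
    have := (one_le_inv₀ hm0).2 hm1
    linarith
  have hmem : x + ((1 : ℝ) + (m⁻¹ - 1)) • (w ⊔ x - x) ∈ cube n := by
    rw [mem_cube_iff]
    intro i
    have h0 := mul_nonneg (inv_nonneg.2 hm0.le) (hd0 i)
    have := hd i
    simp only [Pi.add_apply, Pi.smul_apply, Pi.sub_apply, smul_eq_mul,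
      add_sub_cancel] at *
    exact ⟨by linarith [(hx' i).1], by linarith⟩
  have h := hf.concave_ray hd0 hx zero_le_one hm' hmem
  have h0 := hf.nonneg _ hmem
  simp only [one_smul, add_sub_cancel, one_mul] at h h0
  have h3 : f (x + m⁻¹ • (w ⊔ x - x)) ≥ 0 := h0
  have h4 : - f (w ⊔ x) ≤ (m⁻¹ - 1) * (f (w ⊔ x) - f x) := by linarith
  have h5 := mul_le_mul_of_nonneg_left h4 hm0.le
  have h6 : m * ((m⁻¹ - 1) * (f (w ⊔ x) - f x)) = (1 - m) * (f (w ⊔ x) - f x) := by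
    field_simp
  rw [h6] at h5
  linarith

end IsObjective

/-! ### Feasible points, saturated coordinates and tight sets. -/

theorem IsPolymatroidRank.nonneg (hr : IsPolymatroidRank r) (S : Finset (Fin n)) : 0 ≤ r S :=
  hr.empty ▸ hr.mono ∅ S (Finset.empty_subset S)

theorem mem_feasible_iff {x : Fin n → ℝ} : x ∈ feasible r ↔
    (∀ i, 0 ≤ x i) ∧ (∀ i, x i ≤ 1) ∧ ∀ S : Finset (Fin n), ∑ i ∈ S, x i ≤ r S := by
  simp only [feasible, polymatroid, Set.mem_inter_iff, Set.mem_ofPred_eq, mem_cube_iff, Pi.le_def,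
    Pi.zero_apply]
  grind

theorem feasible_subset_cube : feasible r ⊆ cube n := Set.inter_subset_right

theorem zero_mem_feasible (hr : IsPolymatroidRank r) : (0 : Fin n → ℝ) ∈ feasible r :=
  mem_feasible_iff.2 ⟨by simp, by simp, fun S => by simpa using hr.nonneg S⟩

theorem mem_feasible_of_le {x y : Fin n → ℝ} (hy : y ∈ feasible r) (h0 : 0 ≤ x) (h : x ≤ y) :
    x ∈ feasible r := by
  rw [mem_feasible_iff] at hy ⊢
  exact ⟨h0, fun i => (h i).trans (hy.2.1 i), fun S =>
    (Finset.sum_le_sum fun i _ => h i).trans (hy.2.2 S)⟩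

theorem isCompact_feasible : IsCompact (feasible r) := by
  refine (isCompact_Icc (a := (0 : Fin n → ℝ)) (b := 1)).inter_left ?_
  have : polymatroid r = {x | 0 ≤ x} ∩
      ⋂ S : Finset (Fin n), {x : Fin n → ℝ | ∑ i ∈ S, x i ≤ r S} := by
    ext x
    simp [polymatroid]
  rw [this]
  refine (isClosed_le continuous_const continuous_id).inter (isClosed_iInter fun S => ?_)
  exact isClosed_le (continuous_finsetSum _ fun i _ => continuous_apply i) continuous_const

/-- The coordinate `i` cannot be increased within the feasible set. -/
def IsSaturated (r : Finset (Fin n) → ℝ) (y : Fin n → ℝ) (i : Fin n) : Prop :=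
  ∀ δ > 0, y + Pi.single i δ ∉ feasible r

theorem IsSaturated.mono {y y' : Fin n → ℝ} {i : Fin n} (h : IsSaturated r y i) (h0 : 0 ≤ y)
    (hy : y ≤ y') : IsSaturated r y' i := fun δ hδ hmem =>
  h δ hδ (mem_feasible_of_le hmem (add_nonneg h0 (Pi.single_nonneg.2 hδ.le))
    (add_le_add_left hy _))

/-- Otherwise the least slack among the finitely many constraints involving `i` is positive and
permits an increase. -/
theorem IsSaturated.eq_one_or_tight {y : Fin n → ℝ} {i : Fin n} (h : IsSaturated r y i)
    (hy : y ∈ feasible r) : y i = 1 ∨ ∃ S : Finset (Fin n), i ∈ S ∧ ∑ j ∈ S, y j = r S := by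
  by_contra! hcon
  obtain ⟨h0, h1, hS⟩ := mem_feasible_iff.1 hy
  have hpos : ∀ S : Finset (Fin n), ∃ δ > 0, i ∈ S → ∑ j ∈ S, y j + δ ≤ r S := by
    intro S
    by_cases hi : i ∈ S
    · exact ⟨r S - ∑ j ∈ S, y j, sub_pos.2 (lt_of_le_of_ne (hS S) (hcon.2 S hi)),
        fun _ => by linarith⟩
    · exact ⟨1, one_pos, fun h => absurd h hi⟩
  choose δ hδ0 hδ using hpos
  obtain ⟨S₀, -, hmin⟩ := Finset.exists_min_image Finset.univ δ Finset.univ_nonempty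
  have hi1 : 0 < 1 - y i := sub_pos.2 (lt_of_le_of_ne (h1 i) hcon.1)
  refine h (min (δ S₀) (1 - y i)) (lt_min (hδ0 _) hi1) (mem_feasible_iff.2 ⟨?_, ?_, ?_⟩)
  · intro j
    have : (0 : Fin n → ℝ) ≤ Pi.single i (min (δ S₀) (1 - y i)) :=
      Pi.single_nonneg.2 (le_min (hδ0 _).le hi1.le)
    simpa using add_nonneg (h0 j) (this j)
  · intro j
    rcases eq_or_ne j i with rfl | hj
    · have := min_le_right (δ S₀) (1 - y j)
      simp only [Pi.add_apply, Pi.single_eq_same]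
      linarith
    · simpa [hj] using h1 j
  · intro S
    simp only [Pi.add_apply, Finset.sum_add_distrib, Finset.sum_pi_single']
    split_ifs with hi
    · have := hδ S hi
      have := hmin S (Finset.mem_univ _)
      have := min_le_left (δ S₀) (1 - y i)
      linarith
    · simpa using hS S

/-- Uncrossing: submodularity and the constraint for `S ∩ T` leave no slack at `S ∪ T`. -/
theorem tight_union (hr : IsPolymatroidRank r) {y : Fin n → ℝ} (hy : y ∈ feasible r)
    {S T : Finset (Fin n)} (hS : ∑ j ∈ S, y j = r S) (hT : ∑ j ∈ T, y j = r T) :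
    ∑ j ∈ S ∪ T, y j = r (S ∪ T) := by
  have h := (mem_feasible_iff.1 hy).2.2
  have h1 := Finset.sum_union_inter (s₁ := S) (s₂ := T) (f := y)
  linarith [h (S ∪ T), h (S ∩ T), hr.submodular S T]

theorem exists_max_tight (hr : IsPolymatroidRank r) {y : Fin n → ℝ} (hy : y ∈ feasible r) :
    ∃ T : Finset (Fin n), ∑ j ∈ T, y j = r T ∧
      ∀ S : Finset (Fin n), ∑ j ∈ S, y j = r S → S ⊆ T := by
  obtain ⟨T, hT⟩ := Set.Finite.exists_maximal
    (s := {S : Finset (Fin n) | ∑ j ∈ S, y j = r S}) (Set.toFinite _) ⟨∅, by simp [hr.empty]⟩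
  refine ⟨T, hT.1, fun S hS => ?_⟩
  exact Finset.subset_union_left.trans
    (hT.2 (tight_union hr hy hS hT.1) Finset.subset_union_right)

/-- The saturated coordinates of a feasible point carry at most its total mass in any feasible
point. -/
theorem sum_saturated_le (hr : IsPolymatroidRank r) {y z : Fin n → ℝ} (hy : y ∈ feasible r)
    (hz : z ∈ feasible r) {E : Finset (Fin n)} (hE : ∀ i ∈ E, IsSaturated r y i) :
    ∑ i ∈ E, z i ≤ ∑ i, y i := by
  obtain ⟨T, hT, hmax⟩ := exists_max_tight hr hy
  obtain ⟨hy0, -, -⟩ := mem_feasible_iff.1 hy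
  obtain ⟨hz0, hz1, hzS⟩ := mem_feasible_iff.1 hz
  -- A saturated coordinate outside the largest tight set must have the value 1. Inside `T`,
  -- tightness bounds the mass of `z` by that of `y`.
  have hone : ∀ i ∈ E \ T, z i ≤ y i := by
    intro i hi
    rw [Finset.mem_sdiff] at hi
    rcases (hE i hi.1).eq_one_or_tight hy with h | ⟨S, hiS, hS⟩
    · exact h ▸ hz1 i
    · exact absurd (hmax S hS hiS) hi.2
  calc ∑ i ∈ E, z i ≤ ∑ i ∈ T ∪ E \ T, z i := by
        refine Finset.sum_le_sum_of_subset_of_nonneg ?_ fun i _ _ => hz0 i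
        intro i hi
        by_cases h : i ∈ T <;> simp [h, hi]
    _ = ∑ i ∈ T, z i + ∑ i ∈ E \ T, z i := Finset.sum_union Finset.disjoint_sdiff
    _ ≤ ∑ i ∈ T, y i + ∑ i ∈ E \ T, y i :=
        add_le_add ((hzS T).trans hT.ge) (Finset.sum_le_sum hone)
    _ = ∑ i ∈ T ∪ E \ T, y i := (Finset.sum_union Finset.disjoint_sdiff).symm
    _ ≤ ∑ i, y i := Finset.sum_le_sum_of_subset_of_nonneg (Finset.subset_univ _)
        fun i _ _ => hy0 i

/-- `y'` is a maximal feasible point between `y` and the caps `u`. -/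
def IsMaximalGrowth (r : Finset (Fin n) → ℝ) (y u y' : Fin n → ℝ) : Prop :=
  y' ∈ feasible r ∧ y ≤ y' ∧ y' ≤ u ∧ ∀ i, y' i = u i ∨ IsSaturated r y' i

theorem exists_isMaximalGrowth {y u : Fin n → ℝ} (hy : y ∈ feasible r) (hu : y ≤ u) :
    ∃ y', IsMaximalGrowth r y u y' := by
  have hcomp : IsCompact (feasible r ∩ Set.Icc y u) := isCompact_feasible.inter_right isClosed_Icc
  -- A point of largest total mass is maximal; finding it involves only `r`, so it costs no oracle
  -- call.
  obtain ⟨y', hy', hmax⟩ := hcomp.exists_isMaxOn ⟨y, hy, le_rfl, hu⟩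
    (f := fun y : Fin n → ℝ => ∑ i, y i)
    (continuous_finsetSum _ fun i _ => continuous_apply i).continuousOn
  refine ⟨y', hy'.1, hy'.2.1, hy'.2.2, fun i => ?_⟩
  by_contra! hcon
  have hlt : 0 < u i - y' i := sub_pos.2 (lt_of_le_of_ne (hy'.2.2 i) hcon.1)
  obtain ⟨δ, hδ, hmem⟩ : ∃ δ > 0, y' + Pi.single i δ ∈ feasible r := by
    have := hcon.2
    unfold IsSaturated at this
    push Not at this
    exact this
  set m := min δ (u i - y' i)
  have hm : 0 < m := lt_min hδ hlt
  have hle : (Pi.single i m : Fin n → ℝ) ≤ Pi.single i δ := Pi.single_le_single.2 (min_le_left _ _)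
  have hm0 : (0 : Fin n → ℝ) ≤ Pi.single i m := Pi.single_nonneg.2 hm.le
  have hmem' : y' + Pi.single i m ∈ feasible r ∩ Set.Icc y u := by
    refine ⟨mem_feasible_of_le hmem (add_nonneg hy'.1.1.1 hm0) (add_le_add_right hle _),
      hy'.2.1.trans (le_add_of_nonneg_right hm0), fun j => ?_⟩
    rcases eq_or_ne j i with rfl | hj
    · have := min_le_right δ (u j - y' j)
      simp only [Pi.add_apply, Pi.single_eq_same]
      linarith
    · simpa [hj] using hy'.2.2 j
  have := hmax hmem'
  simp only [Set.mem_ofPred_eq, Pi.add_apply, Finset.sum_add_distrib, Finset.sum_pi_single',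
    Finset.mem_univ, if_true] at this
  linarith

open Classical in
/-- A maximal feasible point between `y` and the caps `u`, or `y` itself if there is none. -/
noncomputable def grow (r : Finset (Fin n) → ℝ) (y u : Fin n → ℝ) : Fin n → ℝ :=
  if h : ∃ y', IsMaximalGrowth r y u y' then h.choose else y

theorem grow_spec {y u : Fin n → ℝ} (hy : y ∈ feasible r) (hu : y ≤ u) :
    IsMaximalGrowth r y u (grow r y u) := by
  have h := exists_isMaximalGrowth hy hu
  rw [grow, dif_pos h]
  exact h.choose_spec

/-! ### Composition of algorithms and the cost of compositions. -/

namespace Algorithm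

/-- Run an algorithm and continue with its output. -/
def bind : Algorithm n → ((Fin n → ℝ) → Algorithm n) → Algorithm n
  | output z, k => k z
  | round m q next, k => round m q fun a => bind (next a) k

theorem result_bind (A : Algorithm n) (k : (Fin n → ℝ) → Algorithm n) :
    (A.bind k).result f = (k (A.result f)).result f := by
  induction A with
  | output z => rfl
  | round m q next ih => exact ih _

theorem rounds_bind (A : Algorithm n) (k : (Fin n → ℝ) → Algorithm n) :
    (A.bind k).rounds f = A.rounds f + (k (A.result f)).rounds f := by
  induction A with
  | output z => simp [bind, rounds, result]
  | round m q next ih =>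
    simp only [bind, rounds, result]
    rw [ih]
    ring

theorem evaluations_bind (A : Algorithm n) (k : (Fin n → ℝ) → Algorithm n) :
    (A.bind k).evaluations f = A.evaluations f + (k (A.result f)).evaluations f := by
  induction A with
  | output z => simp [bind, evaluations, result]
  | round m q next ih =>
    simp only [bind, evaluations, result]
    rw [ih]
    ring

/-- A round with a single query point. -/
def query (p : cube n) (k : ℝ × (Fin n → ℝ) → Algorithm n) : Algorithm n :=
  round 1 (fun _ => p) fun a => k (a 0)

/-- Apply the subroutines `B 0, B 1, …, B (m - 1)` one after the other. -/
def iter (B : ℕ → (Fin n → ℝ) → Algorithm n) : ℕ → (Fin n → ℝ) → Algorithm n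
  | 0, y => output y
  | m + 1, y => (iter B m y).bind (B m)

theorem result_iter_succ (B : ℕ → (Fin n → ℝ) → Algorithm n) (m : ℕ) (y : Fin n → ℝ) :
    (iter B (m + 1) y).result f = (B m ((iter B m y).result f)).result f :=
  result_bind _ _

theorem rounds_iter {B : ℕ → (Fin n → ℝ) → Algorithm n} {b : ℕ}
    (h : ∀ j y, (B j y).rounds f = b) (m : ℕ) (y : Fin n → ℝ) :
    (iter B m y).rounds f = m * b := by
  induction m with
  | zero => simp [iter, rounds]
  | succ m ih => rw [iter, rounds_bind, ih, h]; ring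

theorem evaluations_iter {B : ℕ → (Fin n → ℝ) → Algorithm n} {b : ℕ}
    (h : ∀ j y, (B j y).evaluations f = b) (m : ℕ) (y : Fin n → ℝ) :
    (iter B m y).evaluations f = m * b := by
  induction m with
  | zero => simp [iter, evaluations]
  | succ m ih => rw [iter, evaluations_bind, ih, h]; ring

end Algorithm

/-! ### The accelerated measured continuous greedy algorithm. -/

open Classical in
/-- A point as a query point; points outside of the cube are replaced by `0`. -/
noncomputable def toCube (p : Fin n → ℝ) : cube n := if h : p ∈ cube n then ⟨p, h⟩ else
  ⟨0, zero_mem_cube⟩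

theorem coe_toCube {p : Fin n → ℝ} (h : p ∈ cube n) : (toCube p : Fin n → ℝ) = p := by
  rw [toCube, dif_pos h]

theorem oracle_toCube {p : Fin n → ℝ} (h : p ∈ cube n) : oracle f (toCube p) = (f p, grad f p) := by
  rw [oracle, coe_toCube h]

/-- The point reached from `x` by a damped step of size `η` in the direction `y`. -/
def move (η : ℝ) (x y : Fin n → ℝ) : Fin n → ℝ := fun i => x i + η * (1 - x i) * y i

/-- The upper bound for the next iterate, at which the gradient is inspected. -/
def lookahead (τ : ℝ) (y : Fin n → ℝ) : Fin n → ℝ := fun i => 2 * y i + τ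

/-- The damped gradient of the objective at the lookahead point. -/
noncomputable def weight (f : (Fin n → ℝ) → ℝ) (η τ : ℝ) (x y : Fin n → ℝ) : Fin n → ℝ :=
  fun i => (1 - x i) * grad f (move η x (lookahead τ y)) i

/-- One round: the coordinates whose damped gradient at the lookahead point is at least `v` grow
as far as feasibility and the lookahead point allow. -/
noncomputable def stepAlg (r : Finset (Fin n) → ℝ) (η τ : ℝ) (x : Fin n → ℝ) (v : ℝ)
    (y : Fin n → ℝ) : Algorithm n :=
  Algorithm.query (toCube (move η x (lookahead τ y))) fun a =>
    Algorithm.output (grow r y fun i =>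
      if v ≤ (1 - x i) * a.2 i then lookahead τ y i else y i)

/-- All rounds for a single threshold `v`. -/
noncomputable def levelAlg (r : Finset (Fin n) → ℝ) (η τ : ℝ) (R : ℕ) (x : Fin n → ℝ) (v : ℝ) :
    (Fin n → ℝ) → Algorithm n :=
  Algorithm.iter (fun _ => stepAlg r η τ x v) R

/-- The direction of a phase: thresholds decrease geometrically from `G`. -/
noncomputable def directionAlg (r : Finset (Fin n) → ℝ) (η τ G : ℝ) (R J : ℕ) (x : Fin n → ℝ) :
    Algorithm n :=
  Algorithm.iter (fun j => levelAlg r η τ R x (G * (1 - η) ^ j)) J 0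

/-- A phase: a damped step in the direction computed for the current point. -/
noncomputable def phaseAlg (r : Finset (Fin n) → ℝ) (η τ G : ℝ) (R J : ℕ) (x : Fin n → ℝ) :
    Algorithm n :=
  (directionAlg r η τ G R J x).bind fun y => Algorithm.output (move η x y)

/-- The accelerated measured continuous greedy algorithm. -/
noncomputable def greedyAlg (r : Finset (Fin n) → ℝ) (η τ G : ℝ) (R J N : ℕ) : Algorithm n :=
  Algorithm.iter (fun _ => phaseAlg r η τ G R J) N 0

/-- Every round has exactly one query point, so the number of evaluations is the same. -/
theorem rounds_greedyAlg (η τ G : ℝ) (R J N : ℕ) :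
    (greedyAlg r η τ G R J N).rounds f = N * (J * R) := by
  refine Algorithm.rounds_iter (fun _ x => ?_) N 0
  rw [phaseAlg, Algorithm.rounds_bind, Algorithm.rounds, add_zero]
  refine Algorithm.rounds_iter (fun _ y => ?_) J 0
  rw [levelAlg, Algorithm.rounds_iter (b := 1), mul_one]
  exact fun _ _ => rfl

theorem evaluations_greedyAlg (η τ G : ℝ) (R J N : ℕ) :
    (greedyAlg r η τ G R J N).evaluations f = N * (J * R) := by
  refine Algorithm.evaluations_iter (fun _ x => ?_) N 0
  rw [phaseAlg, Algorithm.evaluations_bind, Algorithm.evaluations, add_zero]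
  refine Algorithm.evaluations_iter (fun _ y => ?_) J 0
  rw [levelAlg, Algorithm.evaluations_iter (b := 1), mul_one]
  exact fun _ _ => rfl

theorem move_mono {η : ℝ} (hη : 0 ≤ η) {x y y' : Fin n → ℝ} (hx : x ∈ cube n) (h : y ≤ y') :
    move η x y ≤ move η x y' := fun i =>
  add_le_add_right (mul_le_mul_of_nonneg_left (h i)
    (mul_nonneg hη (sub_nonneg.2 (mem_cube_iff.1 hx i).2))) _

theorem move_zero (η : ℝ) (x : Fin n → ℝ) : move η x 0 = x := by
  ext i
  simp [move]

theorem move_mem_cube {η : ℝ} (hη : 0 ≤ η) {x y : Fin n → ℝ} (hx : x ∈ cube n) (h0 : 0 ≤ y)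
    (h1 : ∀ i, η * y i ≤ 1) : move η x y ∈ cube n := by
  rw [mem_cube_iff] at hx ⊢
  intro i
  have h2 : 0 ≤ 1 - x i := sub_nonneg.2 (hx i).2
  have h3 : 0 ≤ η * (1 - x i) * y i := mul_nonneg (mul_nonneg hη h2) (h0 i)
  have h4 := mul_le_mul_of_nonneg_left (h1 i) h2
  simp only [move]
  exact ⟨by linarith [(hx i).1], by linarith⟩

theorem lookahead_mono (τ : ℝ) {y y' : Fin n → ℝ} (h : y ≤ y') :
    lookahead τ y ≤ lookahead τ y' := fun i => by
  have := h i
  simp only [lookahead]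
  linarith

theorem le_lookahead {τ : ℝ} (hτ : 0 ≤ τ) {y : Fin n → ℝ} (h : 0 ≤ y) : y ≤ lookahead τ y :=
  fun i => by
  have := h i
  simp only [lookahead, Pi.zero_apply] at *
  linarith

theorem move_lookahead_mem_cube {η τ : ℝ} (hη0 : 0 ≤ η) (hη : 3 * η ≤ 1) (hτ0 : 0 ≤ τ)
    (hτ : τ ≤ 1) {x y : Fin n → ℝ} (hx : x ∈ cube n) (hy : y ∈ cube n) :
    move η x (lookahead τ y) ∈ cube n := by
  rw [mem_cube_iff] at hy
  refine move_mem_cube hη0 hx (fun i => ?_) fun i => ?_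
  · simp only [lookahead, Pi.zero_apply]
    linarith [hy i]
  · have : η * lookahead τ y i ≤ η * 3 := by
      refine mul_le_mul_of_nonneg_left ?_ hη0
      simp only [lookahead]
      linarith [hy i]
    linarith

theorem move_mem_cube' {η : ℝ} (hη0 : 0 ≤ η) (hη : 3 * η ≤ 1) {x y : Fin n → ℝ}
    (hx : x ∈ cube n) (hy : y ∈ cube n) : move η x y ∈ cube n := by
  rw [mem_cube_iff] at hy
  refine move_mem_cube hη0 hx (fun i => (hy i).1) fun i => ?_
  have := mul_le_mul_of_nonneg_left (hy i).2 hη0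
  linarith

/-! ### The gain within one phase. -/

namespace IsObjective

theorem weight_anti (hf : IsObjective f) {η τ : ℝ} (hη0 : 0 ≤ η) (hη : 3 * η ≤ 1) (hτ0 : 0 ≤ τ)
    (hτ : τ ≤ 1) {x y y' : Fin n → ℝ} (hx : x ∈ cube n) (hy : y ∈ cube n) (hy' : y' ∈ cube n)
    (h : y ≤ y') (i : Fin n) : weight f η τ x y' i ≤ weight f η τ x y i :=
  mul_le_mul_of_nonneg_left (hf.grad_anti (move_lookahead_mem_cube hη0 hη hτ0 hτ hx hy)
    (move_lookahead_mem_cube hη0 hη hτ0 hτ hx hy')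
    (move_mono hη0 hx (lookahead_mono τ h)) i) (sub_nonneg.2 (mem_cube_iff.1 hx i).2)

/-- The lookahead point dominates the new point, so the gradient read there underestimates the
gradient at the new point, which in turn underestimates the slope along the whole move. Only
coordinates passing `v` move. -/
theorem step_spec (hf : IsObjective f) {η τ : ℝ} (hη0 : 0 ≤ η) (hη : 3 * η ≤ 1) (hτ0 : 0 ≤ τ)
    (hτ : τ ≤ 1) {x : Fin n → ℝ} (hx : x ∈ cube n) (v : ℝ) {y : Fin n → ℝ}
    (hy : y ∈ feasible r) {y' : Fin n → ℝ} (hy' : y' = (stepAlg r η τ x v y).result f) :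
    y' ∈ feasible r ∧ y ≤ y' ∧
    (∀ i, v ≤ weight f η τ x y i → y' i = lookahead τ y i ∨ IsSaturated r y' i) ∧
    η * v * (∑ i, y' i - ∑ i, y i) ≤ f (move η x y') - f (move η x y) := by
  have hyc := feasible_subset_cube hy
  have hwc := move_lookahead_mem_cube hη0 hη hτ0 hτ hx hyc
  have hyu : y ≤ fun i => if v ≤ weight f η τ x y i then lookahead τ y i else y i := by
    intro i
    dsimp only
    split_ifs
    · exact le_lookahead hτ0 hyc.1 i
    · exact le_rfl
  have hg := grow_spec hy hyu
  have he : y' = grow r y fun i => if v ≤ weight f η τ x y i then lookahead τ y i else y i := by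
    rw [hy']
    simp only [stepAlg, Algorithm.query, Algorithm.result, oracle_toCube hwc, weight]
    congr!
  rw [← he] at hg
  obtain ⟨h1, h2, h3, h4⟩ := hg
  refine ⟨h1, h2, fun i hi => by simpa [hi] using h4 i, ?_⟩
  have h1c := feasible_subset_cube h1
  have hmy := move_mem_cube' hη0 hη hx hyc
  have hmy' := move_mem_cube' hη0 hη hx h1c
  refine le_trans ?_ (hf.sum_grad_le_sub hmy hmy' (move_mono hη0 hx h2))
  rw [← Finset.sum_sub_distrib, Finset.mul_sum]
  refine Finset.sum_le_sum fun i _ => ?_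
  have hle : y' ≤ lookahead τ y := by
    intro j
    refine (h3 j).trans ?_
    dsimp only
    split_ifs
    · exact le_rfl
    · exact le_lookahead hτ0 hyc.1 j
  have hanti := hf.grad_anti hmy' hwc (move_mono hη0 hx hle) i
  have hd : 0 ≤ y' i - y i := sub_nonneg.2 (h2 i)
  have hxi : 0 ≤ 1 - x i := sub_nonneg.2 (mem_cube_iff.1 hx i).2
  have hmove : move η x y' i - move η x y i = η * (1 - x i) * (y' i - y i) := by
    simp only [move]
    ring
  rw [hmove]
  by_cases hv : v ≤ weight f η τ x y i
  · calc η * v * (y' i - y i) ≤ η * weight f η τ x y i * (y' i - y i) := by gcongr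
      _ = η * (1 - x i) * (y' i - y i) * grad f (move η x (lookahead τ y)) i := by
        simp only [weight]
        ring
      _ ≤ _ := by gcongr
  · have : y' i = y i := le_antisymm (by simpa [hv] using h3 i) (h2 i)
    simp [this]

/-- Weights only decrease as `y` grows, so a coordinate passing `v` now has passed it in all rounds
of the level. While unsaturated it follows the caps `2 * y i + τ` and reaches `(2 ^ m - 1) * τ`
after `m` rounds; `hR` excludes this at `m = R`. -/
theorem level_spec (hf : IsObjective f) {η τ : ℝ} (hη0 : 0 ≤ η) (hη : 3 * η ≤ 1) (hτ0 : 0 ≤ τ)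
    (hτ : τ ≤ 1) {R : ℕ} (hR : 1 < ((2 : ℝ) ^ R - 1) * τ) {x : Fin n → ℝ} (hx : x ∈ cube n)
    (v : ℝ) {y : Fin n → ℝ} (hy : y ∈ feasible r) {y' : Fin n → ℝ}
    (hy' : y' = (levelAlg r η τ R x v y).result f) :
    y' ∈ feasible r ∧ y ≤ y' ∧ (∀ i, v ≤ weight f η τ x y' i → IsSaturated r y' i) ∧
    η * v * (∑ i, y' i - ∑ i, y i) ≤ f (move η x y') - f (move η x y) := by
  have key : ∀ (m : ℕ) (w : Fin n → ℝ),
      w = (levelAlg r η τ m x v y).result f →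
      w ∈ feasible r ∧ y ≤ w ∧
      (∀ i, v ≤ weight f η τ x w i → ((2 : ℝ) ^ m - 1) * τ ≤ w i ∨ IsSaturated r w i) ∧
      η * v * (∑ i, w i - ∑ i, y i) ≤ f (move η x w) - f (move η x y) := by
    intro m
    induction m with
    | zero =>
      intro w hw
      obtain rfl : w = y := hw
      exact ⟨hy, le_rfl, fun i _ => Or.inl (by simpa using (mem_feasible_iff.1 hy).1 i), by simp⟩
    | succ m ih =>
      intro w' hw'
      obtain ⟨h1, h2, h3, h4⟩ := ih _ rfl
      rw [levelAlg, Algorithm.result_iter_succ] at hw'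
      change w' = (stepAlg r η τ x v ((levelAlg r η τ m x v y).result f)).result f at hw'
      set w := (levelAlg r η τ m x v y).result f
      obtain ⟨k1, k2, k3, k4⟩ := hf.step_spec hη0 hη hτ0 hτ hx v h1 hw'
      refine ⟨k1, h2.trans k2, fun i hi => ?_, by linarith⟩
      have hi' := hi.trans (hf.weight_anti hη0 hη hτ0 hτ hx (feasible_subset_cube h1)
        (feasible_subset_cube k1) k2 i)
      rcases h3 i hi' with h | h
      · rcases k3 i hi' with k | k
        · left
          rw [k, lookahead, pow_succ]
          linarith
        · exact Or.inr k
      · exact Or.inr (h.mono (feasible_subset_cube h1).1 k2)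
  obtain ⟨h1, h2, h3, h4⟩ := key R y' hy'
  refine ⟨h1, h2, fun i hi => ?_, h4⟩
  rcases h3 i hi with h | h
  · linarith [(mem_feasible_iff.1 h1).2.1 i]
  · exact h

/-- The direction of a phase competes with every feasible direction, for the damped gradient at
the lookahead point. -/
theorem direction_spec (hf : IsObjective f) (hr : IsPolymatroidRank r) {η τ : ℝ} (hη0 : 0 ≤ η)
    (hη : 3 * η ≤ 1) (hτ0 : 0 ≤ τ) (hτ : τ ≤ 1) {R : ℕ} (hR : 1 < ((2 : ℝ) ^ R - 1) * τ)
    {x : Fin n → ℝ} (hx : x ∈ cube n) {G : ℝ} (hG0 : 0 ≤ G) (hG : ∀ i, grad f 0 i ≤ G) (J : ℕ)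
    {z : Fin n → ℝ} (hz : z ∈ feasible r) {y : Fin n → ℝ}
    (hy : y = (directionAlg r η τ G R J x).result f) :
    y ∈ feasible r ∧
    η * ∑ i, ((1 - η) * max 0 (weight f η τ x y i) - G * (1 - η) ^ J) * z i
      ≤ f (move η x y) - f x := by
  have hη1 : 0 ≤ 1 - η := by linarith
  have hz0 := (mem_feasible_iff.1 hz).1
  -- The gain is bounded below by a potential: current mass at the price of the next threshold, plus
  -- the part of `(1 - η) * c` above that threshold, collected along `z`. A free lower bound `c` for
  -- the weights lets the final weights be used at every level.
  have key : ∀ (j : ℕ) (w : Fin n → ℝ), w = (directionAlg r η τ G R j x).result f →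
      w ∈ feasible r ∧ ∀ c : Fin n → ℝ, (∀ i, c i ≤ weight f η τ x w i) →
      η * (G * (1 - η) ^ j * ∑ i, w i +
        ∑ i, max 0 ((1 - η) * c i - G * (1 - η) ^ j) * z i) ≤ f (move η x w) - f x := by
    intro j
    induction j with
    | zero =>
      intro w hw
      obtain rfl : w = 0 := hw
      refine ⟨zero_mem_feasible hr, fun c hc => ?_⟩
      have hcG : ∀ i, max 0 ((1 - η) * c i - G * (1 - η) ^ 0) = 0 := by
        intro i
        refine max_eq_left ?_
        have h1 := hf.grad_anti zero_mem_cube (move_lookahead_mem_cube hη0 hη hτ0 hτ hx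
          zero_mem_cube) (move_lookahead_mem_cube hη0 hη hτ0 hτ hx zero_mem_cube).1 i
        have h2 : c i ≤ G := by
          refine (hc i).trans ?_
          have hxi := mem_cube_iff.1 hx i
          calc (1 - x i) * _ ≤ (1 - x i) * G :=
                mul_le_mul_of_nonneg_left (h1.trans (hG i)) (by linarith)
            _ ≤ G := by nlinarith
        have h3 := mul_le_mul_of_nonneg_left h2 hη1
        have h4 := mul_nonneg hη0 hG0
        linarith
      simp only [hcG]
      simp [move_zero]
    | succ j ih =>
      intro w' hw'
      obtain ⟨h1, h2⟩ := ih _ rfl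
      rw [directionAlg, Algorithm.result_iter_succ] at hw'
      change w' = (levelAlg r η τ R x _ ((directionAlg r η τ G R j x).result f)).result f at hw'
      set w := (directionAlg r η τ G R j x).result f
      obtain ⟨k1, k2, k3, k4⟩ := hf.level_spec hη0 hη hτ0 hτ hR hx _ h1 hw'
      refine ⟨k1, fun c hc => ?_⟩
      set v := G * (1 - η) ^ j with hv
      have hv0 : 0 ≤ v := mul_nonneg hG0 (pow_nonneg hη1 j)
      have hv' : G * (1 - η) ^ (j + 1) = (1 - η) * v := by rw [hv, pow_succ]; ring
      rw [hv']
      have h5 := h2 c fun i => (hc i).trans (hf.weight_anti hη0 hη hτ0 hτ hx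
        (feasible_subset_cube h1) (feasible_subset_cube k1) k2 i)
      have h6 : ∑ i ∈ Finset.univ.filter (fun i => v ≤ c i), z i ≤ ∑ i, w' i := by
        refine sum_saturated_le hr k1 hz fun i hi => k3 i ?_
        exact (Finset.mem_filter.1 hi).2.trans (hc i)
      -- Lowering the threshold raises the truncated terms by at most `η * v`, and only where `v ≤ c
      -- i`: this is what the factor `1 - η` before `c` is for. Those coordinates are saturated, so
      -- the drop in the price of the mass of `w'` pays for the increase.
      have h7 : ∑ i, max 0 ((1 - η) * c i - (1 - η) * v) * z i ≤
          ∑ i, max 0 ((1 - η) * c i - v) * z i +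
            η * v * ∑ i ∈ Finset.univ.filter (fun i => v ≤ c i), z i := by
        rw [Finset.sum_filter, Finset.mul_sum, ← Finset.sum_add_distrib]
        refine Finset.sum_le_sum fun i _ => ?_
        split_ifs with hi
        · rw [← add_mul]
          refine mul_le_mul_of_nonneg_right (max_le ?_ ?_) (hz0 i)
          · exact add_nonneg (le_max_left _ _) (mul_nonneg hη0 hv0)
          · linarith [le_max_right 0 ((1 - η) * c i - v)]
        · rw [max_eq_left]
          · simpa using mul_nonneg (le_max_left 0 ((1 - η) * c i - v)) (hz0 i)
          · nlinarith
      have h8 := mul_le_mul_of_nonneg_left h6 (mul_nonneg hη0 hv0)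
      have h9 := mul_le_mul_of_nonneg_left (h7.trans (add_le_add_right h8 _)) hη0
      linarith
  obtain ⟨h1, h2⟩ := key J y hy
  refine ⟨h1, le_trans ?_ (h2 _ fun i => le_rfl)⟩
  refine mul_le_mul_of_nonneg_left ?_ hη0
  have hv0 : 0 ≤ G * (1 - η) ^ J := mul_nonneg hG0 (pow_nonneg hη1 J)
  have hsum : 0 ≤ ∑ i, y i := Finset.sum_nonneg fun i _ => (mem_feasible_iff.1 h1).1 i
  refine le_trans ?_ (le_add_of_nonneg_left (mul_nonneg hv0 hsum))
  refine Finset.sum_le_sum fun i _ => mul_le_mul_of_nonneg_right ?_ (hz0 i)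
  rcases le_total 0 (weight f η τ x y i) with h | h
  · rw [max_eq_right h]
    exact le_max_right _ _
  · rw [max_eq_left h]
    linarith [le_max_left 0 ((1 - η) * weight f η τ x y i - G * (1 - η) ^ J)]

end IsObjective

namespace IsObjective

/-- The lookahead point exceeds the value of the next iterate by at most the last gain, up to a
small error. -/
theorem lookahead_value_le (hf : IsObjective f) {η τ : ℝ} (hη0 : 0 ≤ η) (hη : 3 * η ≤ 1)
    (hτ0 : 0 ≤ τ) (hτ : τ ≤ 1) {x y : Fin n → ℝ} (hx : x ∈ cube n) (hy : y ∈ cube n) {G : ℝ}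
    (hG0 : 0 ≤ G) (hG : ∀ i, grad f 0 i ≤ G) :
    f (move η x (lookahead τ y)) ≤ 2 * f (move η x y) - f x + η * (n * (τ * G)) := by
  have hx' := mem_cube_iff.1 hx
  have hy2 : (fun i => 2 * y i) ≤ lookahead τ y := fun i => by simp [lookahead, hτ0]
  have hw := move_lookahead_mem_cube hη0 hη hτ0 hτ hx hy
  have hm2 : move η x (fun i => 2 * y i) ∈ cube n := by
    have hy' := mem_cube_iff.1 hy
    refine move_mem_cube hη0 hx (fun i => ?_) fun i => ?_
    · simpa using (hy' i).1
    · have := mul_le_mul_of_nonneg_left (hy' i).2 hη0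
      linarith
  have hd : (0 : Fin n → ℝ) ≤ fun i => η * (1 - x i) * y i := fun i =>
    mul_nonneg (mul_nonneg hη0 (sub_nonneg.2 (hx' i).2)) ((mem_cube_iff.1 hy i).1)
  have e1 : x + ((1 : ℝ) + 1) • (fun i => η * (1 - x i) * y i) = move η x (fun i => 2 * y i) := by
    ext i
    simp only [Pi.add_apply, Pi.smul_apply, smul_eq_mul, move]
    ring
  have e2 : x + (1 : ℝ) • (fun i => η * (1 - x i) * y i) = move η x y := by
    ext i
    simp [move]
  -- Without `τ`, the lookahead point is the doubled step on the same ray. The summand `τ` adds at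
  -- most `η * τ` per coordinate, at slope at most `G`.
  have h1 := hf.concave_ray hd hx zero_le_one zero_le_one (by rw [e1]; exact hm2)
  rw [e1, e2] at h1
  have h2 := hf.sub_le_sum_grad hm2 hw (move_mono hη0 hx hy2)
  have h3 : ∑ i, (move η x (lookahead τ y) i - move η x (fun i => 2 * y i) i) *
      grad f (move η x fun i => 2 * y i) i ≤ ∑ _i : Fin n, η * (τ * G) := by
    refine Finset.sum_le_sum fun i _ => ?_
    have hg : grad f (move η x fun i => 2 * y i) i ≤ G :=
      (hf.grad_anti zero_mem_cube hm2 hm2.1 i).trans (hG i)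
    have e3 : move η x (lookahead τ y) i - move η x (fun i => 2 * y i) i
        = η * τ * (1 - x i) := by
      simp only [move, lookahead]
      ring
    rw [e3]
    have hxi : 0 ≤ 1 - x i := sub_nonneg.2 (hx' i).2
    have hητ := mul_nonneg hη0 hτ0
    calc η * τ * (1 - x i) * _ ≤ η * τ * (1 - x i) * G :=
          mul_le_mul_of_nonneg_left hg (mul_nonneg hητ hxi)
      _ ≤ η * τ * 1 * G := by
          gcongr
          linarith [(hx' i).1]
      _ = η * (τ * G) := by ring
  simp only [Finset.sum_const, Finset.card_univ, Fintype.card_fin, nsmul_eq_mul] at h3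
  linarith

/-- As the lookahead point lies above `x`, joining with `z` raises coordinate `i` by at most `(1 - x
i) * z i`; the damping factor in the weights matches this. -/
theorem sup_sub_le_sum_weight (hf : IsObjective f) {η τ : ℝ} (hη0 : 0 ≤ η) (hη : 3 * η ≤ 1)
    (hτ0 : 0 ≤ τ) (hτ : τ ≤ 1) {x y z : Fin n → ℝ} (hx : x ∈ cube n) (hy : y ∈ cube n)
    (hz : z ∈ cube n) :
    f (move η x (lookahead τ y) ⊔ z) - f (move η x (lookahead τ y)) ≤
      ∑ i, max 0 (weight f η τ x y i) * z i := by
  have hw := move_lookahead_mem_cube hη0 hη hτ0 hτ hx hy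
  have hxw : x ≤ move η x (lookahead τ y) := by
    have := move_mono hη0 hx (hy.1.trans (le_lookahead hτ0 hy.1))
    rwa [move_zero] at this
  have hw' : move η x (lookahead τ y) ⊔ z ∈ cube n := ⟨hw.1.trans le_sup_left, sup_le hw.2 hz.2⟩
  refine (hf.sub_le_sum_grad hw hw' le_sup_left).trans (Finset.sum_le_sum fun i _ => ?_)
  simp only [weight]
  set w := move η x (lookahead τ y)
  have hxi := mem_cube_iff.1 hx i
  have hzi := mem_cube_iff.1 hz i
  have hxi' : 0 ≤ 1 - x i := by linarith
  have hd0 : 0 ≤ (w ⊔ z) i - w i := sub_nonneg.2 (le_sup_left (a := w i))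
  have hd : (w ⊔ z) i - w i ≤ (1 - x i) * z i := by
    rw [sub_le_iff_le_add]
    refine sup_le ?_ ?_
    · linarith [mul_nonneg hxi' hzi.1]
    · nlinarith [hxw i]
  rcases le_total 0 (grad f w i) with h | h
  · rw [max_eq_right (mul_nonneg hxi' h)]
    calc _ ≤ (1 - x i) * z i * grad f w i := mul_le_mul_of_nonneg_right hd h
      _ = _ := by ring
  · rw [max_eq_left (mul_nonpos_of_nonneg_of_nonpos hxi' h), zero_mul]
    exact mul_nonpos_of_nonneg_of_nonpos hd0 h

end IsObjective

/-! ### The recurrence from one phase to the next. -/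

/-- Parameters for which the algorithm is accurate on `f`, if the optimum is at least `O`. -/
structure IsTuned (f : (Fin n → ℝ) → ℝ) (η τ G O : ℝ) (R J : ℕ) : Prop where
  η_pos : 0 < η
  η_le : 6 * η ≤ 1
  τ_nonneg : 0 ≤ τ
  τ_le : τ ≤ 1
  one_lt : 1 < ((2 : ℝ) ^ R - 1) * τ
  G_nonneg : 0 ≤ G
  grad_le : ∀ i, grad f 0 i ≤ G
  growth_le : n * (τ * G) ≤ η * O
  threshold_le : n * (G * (1 - η) ^ J) ≤ η * O

/-- Here `a` and `b` are the values before and after the phase, `w` the value at the lookahead point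
and `B` the value of its join with the optimum. Substituting `w ≤ 2 * b - a + η * E₁` moves `b` to
the left with coefficient `2 * η`. The loss `6 * η` collects `4 * η` from the factors `1 - η` and `1
- 3 * η`, one `η` from `E₂` and at most one from `E₁`. -/
theorem phase_recurrence {η a b w B β O E₁ E₂ : ℝ} (hη0 : 0 < η) (hη : 6 * η ≤ 1) (hO : 0 ≤ O)
    (hw0 : 0 ≤ w) (hβ0 : 0 ≤ β) (hβ : β ≤ 1) (hB : (1 - 3 * η) * β * O ≤ B)
    (hE₁ : E₁ ≤ η * O) (hE₂ : E₂ ≤ η * O) (hw : w ≤ 2 * b - a + η * E₁)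
    (h : η * ((1 - η) * (B - w) - E₂) ≤ b - a) :
    (1 + η) * a + η * (β - 6 * η) * O ≤ (1 + 2 * η) * b := by
  have h1 : w ≤ 2 * b - a + η * (η * O) := hw.trans (by gcongr)
  have h2 : (1 - η) * ((1 - 3 * η) * β * O) ≤ (1 - η) * B :=
    mul_le_mul_of_nonneg_left hB (by linarith)
  have hβO : 0 ≤ β * O := mul_nonneg hβ0 hO
  have hβO1 : β * O ≤ O := by nlinarith
  have h3 : β * O - 4 * η * O ≤ (1 - η) * ((1 - 3 * η) * β * O) := by
    have e : (1 - η) * ((1 - 3 * η) * β * O)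
        = β * O - 4 * (η * (β * O)) + 3 * (η * η * (β * O)) := by ring
    have e1 : 0 ≤ η * η * (β * O) := by positivity
    have e2 : η * (β * O) ≤ η * O := mul_le_mul_of_nonneg_left hβO1 hη0.le
    rw [e]
    linarith
  have h4 : (1 - η) * w ≤ w := by nlinarith
  have h5 : (β * O - 4 * η * O) - (2 * b - a + η * (η * O)) - η * O
      ≤ (1 - η) * (B - w) - E₂ := by linarith
  have h6 := (mul_le_mul_of_nonneg_left h5 hη0.le).trans h
  have h7 : η * (η * (η * O)) ≤ η * (η * O) := by
    have : 0 ≤ η * (η * O) := by positivity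
    nlinarith
  nlinarith

namespace IsTuned

variable {η τ G : ℝ} {R J : ℕ} {xopt : Fin n → ℝ}

/-- The parameter `β` is the fraction of the optimum kept by the join: `(1 - η) ^ j` in general, 1
for monotone objectives, and 0 when only feasibility of the direction is wanted. -/
theorem phase_bound (ht : IsTuned f η τ G (f xopt) R J) (hf : IsObjective f)
    (hr : IsPolymatroidRank r) (hopt : xopt ∈ feasible r) {x : Fin n → ℝ} (hx : x ∈ cube n)
    {β : ℝ} (hβ0 : 0 ≤ β) (hβ : β ≤ 1)
    (hβx : ∀ y ∈ cube n, (1 - 3 * η) * β * f xopt ≤ f (move η x (lookahead τ y) ⊔ xopt)) :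
    ∃ y ∈ feasible r, (phaseAlg r η τ G R J x).result f = move η x y ∧
      (1 + η) * f x + η * (β - 6 * η) * f xopt ≤ (1 + 2 * η) * f (move η x y) := by
  have hη0 := ht.η_pos.le
  have hη : 3 * η ≤ 1 := by linarith [ht.η_le]
  obtain ⟨hy, hgain⟩ := hf.direction_spec hr hη0 hη ht.τ_nonneg ht.τ_le ht.one_lt hx
    ht.G_nonneg ht.grad_le J hopt rfl
  refine ⟨_, hy, by rw [phaseAlg, Algorithm.result_bind]; rfl, ?_⟩
  set y := (directionAlg r η τ G R J x).result f
  have hyc := feasible_subset_cube hy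
  have hoc := feasible_subset_cube hopt
  refine phase_recurrence ht.η_pos ht.η_le (hf.nonneg _ hoc)
    (hf.nonneg _ (move_lookahead_mem_cube hη0 hη ht.τ_nonneg ht.τ_le hx hyc)) hβ0 hβ (hβx y hyc)
    ht.growth_le ht.threshold_le
    (hf.lookahead_value_le hη0 hη ht.τ_nonneg ht.τ_le hx hyc ht.G_nonneg ht.grad_le)
    (le_trans (mul_le_mul_of_nonneg_left ?_ hη0) hgain)
  have h1 := hf.sup_sub_le_sum_weight hη0 hη ht.τ_nonneg ht.τ_le hx hyc hoc
  have hv0 : 0 ≤ G * (1 - η) ^ J :=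
    mul_nonneg ht.G_nonneg (pow_nonneg (by linarith [ht.η_le]) J)
  have h2 : ∑ i, G * (1 - η) ^ J * xopt i ≤ n * (G * (1 - η) ^ J) := by
    calc ∑ i, G * (1 - η) ^ J * xopt i ≤ ∑ _i : Fin n, G * (1 - η) ^ J :=
          Finset.sum_le_sum fun i _ => mul_le_of_le_one_right hv0 (mem_cube_iff.1 hoc i).2
      _ = _ := by simp
  have h3 : ∑ i, ((1 - η) * max 0 (weight f η τ x y i) - G * (1 - η) ^ J) * xopt i
      = (1 - η) * ∑ i, max 0 (weight f η τ x y i) * xopt i -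
        ∑ i, G * (1 - η) ^ J * xopt i := by
    rw [Finset.mul_sum, ← Finset.sum_sub_distrib]
    exact Finset.sum_congr rfl fun i _ => by ring
  rw [h3]
  have h4 := mul_le_mul_of_nonneg_left h1 (by linarith : 0 ≤ 1 - η)
  linarith

theorem greedy_invariant (ht : IsTuned f η τ G (f xopt) R J) (hf : IsObjective f)
    (hr : IsPolymatroidRank r) (hopt : xopt ∈ feasible r) (j : ℕ) :
    (greedyAlg r η τ G R J j).result f ∈ cube n ∧
    (∀ S : Finset (Fin n), ∑ i ∈ S, (greedyAlg r η τ G R J j).result f i ≤ j * η * r S) ∧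
    (∀ i, (1 - η) ^ j ≤ 1 - (greedyAlg r η τ G R J j).result f i) ∧
    (1 + η) * f ((greedyAlg r η τ G R J j).result f) + η * ((1 - η) ^ j - 6 * η) * f xopt ≤
      (1 + 2 * η) * f ((greedyAlg r η τ G R J (j + 1)).result f) ∧
    (MonotoneOn f (cube n) →
      (1 + η) * f ((greedyAlg r η τ G R J j).result f) + η * (1 - 6 * η) * f xopt ≤
        (1 + 2 * η) * f ((greedyAlg r η τ G R J (j + 1)).result f)) := by
  have hη0 := ht.η_pos.le
  have hη : 3 * η ≤ 1 := by linarith [ht.η_le]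
  have hη1 : 0 ≤ 1 - η := by linarith
  have hsucc : ∀ j, (greedyAlg r η τ G R J (j + 1)).result f =
      (phaseAlg r η τ G R J ((greedyAlg r η τ G R J j).result f)).result f := fun j =>
    Algorithm.result_iter_succ _ _ _
  have hoc := feasible_subset_cube hopt
  have hO := hf.nonneg _ hoc
  have main : ∀ x ∈ cube n, (∀ i, (1 - η) ^ j ≤ 1 - x i) →
      (1 + η) * f x + η * ((1 - η) ^ j - 6 * η) * f xopt ≤
        (1 + 2 * η) * f ((phaseAlg r η τ G R J x).result f) ∧
      (MonotoneOn f (cube n) → (1 + η) * f x + η * (1 - 6 * η) * f xopt ≤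
        (1 + 2 * η) * f ((phaseAlg r η τ G R J x).result f)) := by
    intro x hx hxj
    have hp0 : 0 ≤ (1 - η) ^ j := pow_nonneg hη1 j
    have hp1 : (1 - η) ^ j ≤ 1 := pow_le_one₀ hη1 (by linarith)
    constructor
    · obtain ⟨y, -, he, h⟩ := ht.phase_bound hf hr hopt hx hp0 hp1 fun y hy => by
        -- The lookahead direction has entries at most 3, so it shrinks `1 - x i` by a factor no
        -- smaller than `1 - 3 * η`.
        have hm : ∀ i, move η x (lookahead τ y) i ≤ 1 - (1 - 3 * η) * (1 - η) ^ j := by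
          intro i
          have hyi := mem_cube_iff.1 hy i
          have h1 := mul_le_mul_of_nonneg_left (hxj i) (by linarith : 0 ≤ 1 - 3 * η)
          have hxi : 0 ≤ η * (1 - x i) :=
            mul_nonneg hη0 (sub_nonneg.2 (mem_cube_iff.1 hx i).2)
          have h2 : η * (1 - x i) * (2 * y i + τ) ≤ η * (1 - x i) * 3 :=
            mul_le_mul_of_nonneg_left (by linarith [ht.τ_le]) hxi
          simp only [move, lookahead]
          linarith
        have h3 : (1 - 3 * η) * (1 - η) ^ j ≤ (1 - 3 * η) * 1 :=
          mul_le_mul_of_nonneg_left hp1 (by linarith)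
        have h4 : 0 ≤ (1 - 3 * η) * (1 - η) ^ j := mul_nonneg (by linarith) hp0
        have := hf.mul_le_sup hoc (by linarith [ht.η_pos]) (by linarith) hm
        rwa [sub_sub_cancel] at this
      rwa [he]
    · intro hmono
      obtain ⟨y, -, he, h⟩ := ht.phase_bound hf hr hopt hx zero_le_one le_rfl fun y hy => by
        have hw := move_lookahead_mem_cube hη0 hη ht.τ_nonneg ht.τ_le hx hy
        have := hmono hoc (⟨hw.1.trans le_sup_left, sup_le hw.2 hoc.2⟩ :
          move η x (lookahead τ y) ⊔ xopt ∈ cube n) le_sup_right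
        nlinarith [mul_nonneg hη0 hO]
      rwa [he]
  have inv : ∀ j : ℕ, (greedyAlg r η τ G R J j).result f ∈ cube n ∧
      (∀ S : Finset (Fin n), ∑ i ∈ S, (greedyAlg r η τ G R J j).result f i ≤ j * η * r S) ∧
      (∀ i, (1 - η) ^ j ≤ 1 - (greedyAlg r η τ G R J j).result f i) := by
    intro j
    induction j with
    | zero =>
      have h0 : (greedyAlg r η τ G R J 0).result f = 0 := rfl
      rw [h0]
      exact ⟨zero_mem_cube, by simp, by simp⟩
    | succ j ih =>
      rw [hsucc]
      set x := (greedyAlg r η τ G R J j).result f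
      obtain ⟨hx, hS, hi⟩ := ih
      obtain ⟨y, hy, he, -⟩ := ht.phase_bound hf hr hopt hx (β := 0) le_rfl zero_le_one
        fun y hy => by
          have hw := move_lookahead_mem_cube hη0 hη ht.τ_nonneg ht.τ_le hx hy
          simpa using hf.nonneg _ (⟨hw.1.trans le_sup_left, sup_le hw.2 hoc.2⟩ :
            move η x (lookahead τ y) ⊔ xopt ∈ cube n)
      rw [he]
      have hyc := feasible_subset_cube hy
      refine ⟨move_mem_cube' hη0 hη hx hyc, fun S => ?_, fun i => ?_⟩
      · have h1 : ∑ i ∈ S, move η x y i ≤ ∑ i ∈ S, (x i + η * y i) := by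
          refine Finset.sum_le_sum fun i _ => ?_
          have hxi := mem_cube_iff.1 hx i
          have := mul_nonneg (mul_nonneg hη0 hxi.1) ((mem_cube_iff.1 hyc i).1)
          simp only [move]
          linarith
        rw [Finset.sum_add_distrib, ← Finset.mul_sum] at h1
        have h2 := mul_le_mul_of_nonneg_left ((mem_feasible_iff.1 hy).2.2 S) hη0
        push_cast
        linarith [hS S]
      · have hyi := mem_cube_iff.1 hyc i
        have hxi : 0 ≤ η * (1 - x i) :=
          mul_nonneg hη0 (sub_nonneg.2 (mem_cube_iff.1 hx i).2)
        have h1 := mul_le_mul_of_nonneg_left hyi.2 hxi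
        have h2 := mul_le_mul_of_nonneg_right (hi i) hη1
        rw [pow_succ]
        simp only [move]
        linarith
  rw [hsucc]
  exact ⟨(inv j).1, (inv j).2.1, (inv j).2.2, main _ (inv j).1 (inv j).2.2⟩

end IsTuned

/-! ### Solving the recurrences. -/

theorem exp_neg_one_le_pow {N : ℕ} {η : ℝ} (hη : ((N : ℝ) + 1) * η = 1) :
    Real.exp (-1) ≤ (1 - η) ^ N := by
  rcases Nat.eq_zero_or_pos N with rfl | hN
  · simp
  have hN' : (0 : ℝ) < N := by exact_mod_cast hN
  have h1 : (1 - η) * (1 + 1 / N) = 1 := by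
    field_simp
    linarith
  have h2 : (1 + 1 / (N : ℝ)) ^ N ≤ Real.exp 1 := by
    calc (1 + 1 / (N : ℝ)) ^ N ≤ Real.exp (1 / N) ^ N := by
          gcongr
          linarith [Real.add_one_le_exp (1 / (N : ℝ))]
      _ = Real.exp 1 := by
          rw [← Real.exp_nat_mul]
          congr 1
          field_simp
  have h3 : (1 - η) ^ N * (1 + 1 / (N : ℝ)) ^ N = 1 := by rw [← mul_pow, h1, one_pow]
  have h4 : 0 < (1 + 1 / (N : ℝ)) ^ N := by positivity
  rw [Real.exp_neg, inv_le_iff_one_le_mul₀ (Real.exp_pos 1)]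
  refine h3.symm.le.trans (mul_le_mul_of_nonneg_left h2 ?_)
  by_contra! hcon
  linarith [mul_neg_of_neg_of_pos hcon h4]

/-- The induction claim is the discrete form of t·exp(-t). It propagates because `(1 - η) * (1 + 2 *
η) ≤ 1 + η`. The last phase has index `N`, whence `(N + 1) * η = 1` and `(1 - η) ^ N` is still at
least 1/e. -/
theorem general_value_bound {a : ℕ → ℝ} {η O : ℝ} {N : ℕ} (hη0 : 0 < η) (hη : 6 * η ≤ 1)
    (hO : 0 ≤ O) (hN : ((N : ℝ) + 1) * η = 1) (ha0 : ∀ j, 0 ≤ a j)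
    (ha : ∀ j, (1 + η) * a j + η * ((1 - η) ^ j - 6 * η) * O ≤ (1 + 2 * η) * a (j + 1)) :
    (1 / Real.exp 1 - 8 * η) * O ≤ a (N + 1) := by
  have h : ∀ j : ℕ, ((j : ℝ) + 1) * η * ((1 - η) ^ j - 6 * η) * O ≤ (1 + 2 * η) * a (j + 1) := by
    intro j
    induction j with
    | zero =>
      have h1 := ha 0
      have h2 := mul_nonneg (by linarith : 0 ≤ 1 + η) (ha0 0)
      simp only [pow_zero, Nat.cast_zero, zero_add, one_mul] at *
      linarith
    | succ j ih =>
      have h1 := ha (j + 1)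
      have h2 : (1 - η) * ((1 + 2 * η) * a (j + 1)) ≤ (1 + η) * a (j + 1) := by
        nlinarith [ha0 (j + 1), mul_nonneg (mul_nonneg hη0.le hη0.le) (ha0 (j + 1))]
      have h3 := mul_le_mul_of_nonneg_left ih (by linarith : 0 ≤ 1 - η)
      have h4 : 0 ≤ ((j : ℝ) + 1) * η * (6 * η * η) * O := by positivity
      have e : (1 - η) * (((j : ℝ) + 1) * η * ((1 - η) ^ j - 6 * η) * O)
          = ((j : ℝ) + 1) * η * ((1 - η) ^ (j + 1) - 6 * η) * O +
            ((j : ℝ) + 1) * η * (6 * η * η) * O := by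
        rw [pow_succ]
        ring
      push_cast
      rw [e] at h3
      linarith
  have h1 := h N
  rw [hN, one_mul] at h1
  have h2 := exp_neg_one_le_pow hN
  rw [Real.exp_neg, ← one_div] at h2
  have h3 : 1 / Real.exp 1 ≤ 1 := by
    rw [div_le_one (Real.exp_pos 1)]
    exact Real.one_le_exp zero_le_one
  set e := 1 / Real.exp 1
  have h4 : (e - 8 * η) * (1 + 2 * η) ≤ (1 - η) ^ N - 6 * η := by nlinarith
  have h5 := mul_le_mul_of_nonneg_right h4 hO
  have h6 : (1 + 2 * η) * ((e - 8 * η) * O) ≤ (1 + 2 * η) * a (N + 1) := by linarith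
  exact le_of_mul_le_mul_left h6 (by linarith)

/-- The deficit from `(1 - 6 * η) * O` contracts by `(1 + η) / (1 + 2 * η) = 1 - l` per phase, and
`N * l ≥ 1 - 2 * η`. -/
theorem monotone_value_bound {a : ℕ → ℝ} {η O : ℝ} {N : ℕ} (hη0 : 0 < η) (hη : 6 * η ≤ 1)
    (hO : 0 ≤ O) (hN : (N : ℝ) * η = 1) (ha0 : 0 ≤ a 0)
    (ha : ∀ j, (1 + η) * a j + η * (1 - 6 * η) * O ≤ (1 + 2 * η) * a (j + 1)) :
    (1 - 1 / Real.exp 1 - 10 * η) * O ≤ a N := by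
  set l := η / (1 + 2 * η) with hl
  have hpos : 0 < 1 + 2 * η := by linarith
  have hlη : l * (1 + 2 * η) = η := by rw [hl]; field_simp
  have hl1 : 0 ≤ 1 - l := by
    have : l ≤ 1 := by
      rw [hl, div_le_one hpos]
      linarith
    linarith
  have hO' : 0 ≤ (1 - 6 * η) * O := mul_nonneg (by linarith) hO
  have h : ∀ j : ℕ, (1 - 6 * η) * O - a j ≤ (1 - l) ^ j * ((1 - 6 * η) * O) := by
    intro j
    induction j with
    | zero => simpa using ha0
    | succ j ih =>
      have h1 := mul_le_mul_of_nonneg_left ih hl1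
      have h2 : (1 + 2 * η) * ((1 - 6 * η) * O - a (j + 1)) ≤
          (1 + 2 * η) * ((1 - l) * ((1 - 6 * η) * O - a j)) := by
        have e : (1 + 2 * η) * ((1 - l) * ((1 - 6 * η) * O - a j)) =
            ((1 + 2 * η) - l * (1 + 2 * η)) * ((1 - 6 * η) * O - a j) := by ring
        rw [e, hlη]
        linarith [ha j]
      have h3 := le_of_mul_le_mul_left h2 hpos
      rw [pow_succ]
      linarith
  have h1 := h N
  have h2 : (1 - l) ^ N ≤ Real.exp (-1) * (1 + 4 * η) := by
    have e1 : (1 - l) ^ N ≤ Real.exp (-l) ^ N := by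
      gcongr
      linarith [Real.add_one_le_exp (-l)]
    have e2 : Real.exp (-l) ^ N ≤ Real.exp (-1) * Real.exp (2 * η) := by
      rw [← Real.exp_nat_mul, ← Real.exp_add, Real.exp_le_exp]
      have : (N : ℝ) * l = 1 / (1 + 2 * η) := by
        rw [hl, ← mul_div_assoc, hN]
      have h3 : 1 - 2 * η ≤ 1 / (1 + 2 * η) := by
        rw [le_div_iff₀ hpos]
        nlinarith
      linarith
    have e3 : Real.exp (2 * η) ≤ 1 + 4 * η := by
      have h3 := Real.add_one_le_exp (-(2 * η))
      rw [Real.exp_neg] at h3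
      have h4 := Real.exp_pos (2 * η)
      have h5 : (-(2 * η) + 1) * Real.exp (2 * η) ≤ 1 := by
        calc _ ≤ (Real.exp (2 * η))⁻¹ * Real.exp (2 * η) := by gcongr
          _ = 1 := inv_mul_cancel₀ h4.ne'
      have h6 : 1 ≤ (-(2 * η) + 1) * (1 + 4 * η) := by nlinarith
      exact le_of_mul_le_mul_left (h5.trans h6) (by linarith)
    exact e1.trans (e2.trans (by gcongr))
  rw [Real.exp_neg, ← one_div] at h2
  have h3 : 1 / Real.exp 1 ≤ 1 := by
    rw [div_le_one (Real.exp_pos 1)]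
    exact Real.one_le_exp zero_le_one
  have h3' : 0 ≤ 1 / Real.exp 1 := by positivity
  set e := 1 / Real.exp 1
  have h4 := mul_le_mul_of_nonneg_right h2 hO'
  have h5 : (1 - e - 10 * η) * O ≤ (1 - e * (1 + 4 * η)) * ((1 - 6 * η) * O) := by
    rw [← mul_assoc]
    refine mul_le_mul_of_nonneg_right ?_ hO
    nlinarith [mul_nonneg h3' hη0.le, mul_nonneg (mul_nonneg h3' hη0.le) hη0.le]
  linarith

/-- The guarantees of the accelerated measured continuous greedy algorithm. -/
theorem IsTuned.greedy_spec {η τ G : ℝ} {R J N : ℕ} {xopt : Fin n → ℝ}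
    (ht : IsTuned f η τ G (f xopt) R J) (hf : IsObjective f) (hr : IsPolymatroidRank r)
    (hopt : xopt ∈ feasible r) (hN : (N : ℝ) * η = 1) :
    (greedyAlg r η τ G R J N).result f ∈ feasible r ∧
    (MonotoneOn f (cube n) → (1 - 1 / Real.exp 1 - 10 * η) * f xopt ≤
      f ((greedyAlg r η τ G R J N).result f)) ∧
    (1 / Real.exp 1 - 8 * η) * f xopt ≤ f ((greedyAlg r η τ G R J N).result f) := by
  have hinv := ht.greedy_invariant hf hr hopt
  have hO := hf.nonneg _ (feasible_subset_cube hopt)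
  obtain ⟨h1, h2, -⟩ := hinv N
  refine ⟨mem_feasible_iff.2 ⟨fun i => (mem_cube_iff.1 h1 i).1, fun i => (mem_cube_iff.1 h1 i).2,
    fun S => by simpa [hN] using h2 S⟩, fun hmono => ?_, ?_⟩
  · exact monotone_value_bound (a := fun j => f ((greedyAlg r η τ G R J j).result f)) ht.η_pos
      ht.η_le hO hN (hf.nonneg _ (hinv 0).1) fun j => (hinv j).2.2.2.2 hmono
  · obtain ⟨M, rfl⟩ : ∃ M, N = M + 1 := Nat.exists_eq_succ_of_ne_zero (by
      rintro rfl
      simp at hN)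
    exact general_value_bound (a := fun j => f ((greedyAlg r η τ G R J j).result f)) ht.η_pos
      ht.η_le hO (by exact_mod_cast hN) (fun j => hf.nonneg _ (hinv j).1)
      fun j => (hinv j).2.2.2.1

/-! ### Exhaustive search without a gradient assumption. -/

/-- An upper bound for the entries of a gradient. -/
def gradBound (g : Fin n → ℝ) : ℝ := ∑ i, max 0 (g i)

theorem gradBound_nonneg (g : Fin n → ℝ) : 0 ≤ gradBound g :=
  Finset.sum_nonneg fun _ _ => le_max_left _ _

theorem le_gradBound (g : Fin n → ℝ) (i : Fin n) : g i ≤ gradBound g :=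
  (le_max_right 0 (g i)).trans
    (Finset.single_le_sum (f := fun i => max 0 (g i)) (fun _ _ => le_max_left _ _)
      (Finset.mem_univ i))

open Classical in
/-- Evaluate the points `p` in a single round and return the best feasible one. -/
noncomputable def searchAlg (r : Finset (Fin n) → ℝ) {m : ℕ} (p : Fin m → Fin n → ℝ) :
    Algorithm n :=
  Algorithm.round m (fun j => toCube (p j)) fun a => Algorithm.output
    (if h : ∃ j, p j ∈ feasible r ∧ ∀ k, p k ∈ feasible r → (a k).1 ≤ (a j).1 then p h.choose
      else 0)

theorem searchAlg_spec {m : ℕ} {p : Fin m → Fin n → ℝ} {j : Fin m} (hj : p j ∈ feasible r) :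
    (searchAlg r p).result f ∈ feasible r ∧ f (p j) ≤ f ((searchAlg r p).result f) := by
  classical
  have h : ∃ j, p j ∈ feasible r ∧ ∀ k, p k ∈ feasible r →
      (oracle f (toCube (p k))).1 ≤ (oracle f (toCube (p j))).1 := by
    obtain ⟨i, hi, hmax⟩ := Finset.exists_max_image (Finset.univ.filter fun j => p j ∈ feasible r)
      (fun j => (oracle f (toCube (p j))).1) ⟨j, by simpa using hj⟩
    exact ⟨i, by simpa using hi, fun k hk => hmax k (by simpa using hk)⟩
  have e : (searchAlg r p).result f = p h.choose := by
    simp only [searchAlg, Algorithm.result]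
    rw [dif_pos h]
  rw [e]
  refine ⟨h.choose_spec.1, ?_⟩
  have := h.choose_spec.2 j hj
  rwa [oracle_toCube (feasible_subset_cube hj),
    oracle_toCube (feasible_subset_cube h.choose_spec.1)] at this

/-- The points of `[0,1]^n` with coordinates in `{0, 1/D, …, 1}`. -/
noncomputable def grid (n D : ℕ) (j : Fin (Fintype.card (Fin n → Fin (D + 1)))) : Fin n → ℝ :=
  fun i => (((Fintype.equivFin (Fin n → Fin (D + 1))).symm j i : ℕ) : ℝ) / D

theorem exists_grid_near {D : ℕ} (hD : 0 < D) {x : Fin n → ℝ} (hx : x ∈ cube n) :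
    ∃ j, 0 ≤ grid n D j ∧ grid n D j ≤ x ∧ ∀ i, x i - grid n D j i ≤ 1 / D := by
  have hx' := mem_cube_iff.1 hx
  have hD' : (0 : ℝ) < D := by exact_mod_cast hD
  have hfl : ∀ i, ⌊x i * D⌋₊ < D + 1 := by
    intro i
    rw [Nat.lt_succ_iff]
    refine Nat.floor_le_of_le ?_
    nlinarith [(hx' i).2]
  refine ⟨Fintype.equivFin _ fun i => ⟨⌊x i * D⌋₊, hfl i⟩, ?_⟩
  have e : ∀ i, grid n D (Fintype.equivFin _ fun i => ⟨⌊x i * D⌋₊, hfl i⟩) i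
      = (⌊x i * D⌋₊ : ℝ) / D := fun i => by simp [grid]
  refine ⟨fun i => ?_, fun i => ?_, fun i => ?_⟩ <;> rw [e]
  · simp only [Pi.zero_apply]
    positivity
  · rw [div_le_iff₀ hD']
    exact Nat.floor_le (mul_nonneg (hx' i).1 hD'.le)
  · rw [sub_le_iff_le_add, ← add_div, le_div_iff₀ hD', add_comm]
    exact (Nat.lt_floor_add_one _).le

/-- The points `0` and, for every coordinate, half of the largest feasible multiple of the unit
vector. -/
noncomputable def probe (r : Finset (Fin n) → ℝ) : Option (Fin n) → Fin n → ℝ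
  | none => 0
  | some i => Pi.single i (min 1 (r {i}) / 2)

theorem probe_mem_feasible (hr : IsPolymatroidRank r) (o : Option (Fin n)) :
    probe r o ∈ feasible r := by
  cases o with
  | none => exact zero_mem_feasible hr
  | some i =>
    have h0 : 0 ≤ min 1 (r {i}) / 2 := div_nonneg (le_min zero_le_one (hr.nonneg _)) two_pos.le
    have h1 : min 1 (r {i}) / 2 ≤ 1 := by linarith [min_le_left 1 (r {i})]
    have h2 : min 1 (r {i}) / 2 ≤ r {i} := by linarith [min_le_right 1 (r {i}), hr.nonneg {i}]
    have hs : (0 : Fin n → ℝ) ≤ Pi.single i (min 1 (r {i}) / 2) := Pi.single_nonneg.2 h0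
    refine mem_feasible_iff.2 ⟨hs, fun j => ?_, fun S => ?_⟩
    · rcases eq_or_ne j i with rfl | hj
      · simpa [probe] using h1
      · simp [probe, hj]
    · simp only [probe, Finset.sum_pi_single']
      split_ifs with hi
      · exact h2.trans (hr.mono _ _ (Finset.singleton_subset_iff.2 hi))
      · exact hr.nonneg S

/-- If the objective vanishes at all probe points, then it vanishes at its maximum. -/
theorem IsObjective.le_zero_of_probe (hf : IsObjective f)
    (h : ∀ o, f (probe r o) = 0) {x : Fin n → ℝ} (hx : x ∈ feasible r) : f x ≤ 0 := by
  have hxc := feasible_subset_cube hx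
  have h0 : f 0 = 0 := h none
  have h1 := hf.sub_le_sum_grad zero_mem_cube hxc hxc.1
  rw [h0, sub_zero] at h1
  refine h1.trans (Finset.sum_nonpos fun i _ => ?_)
  obtain ⟨hx0, hx1, hxS⟩ := mem_feasible_iff.1 hx
  rcases (hx0 i).eq_or_lt with hi | hi
  · simp [← hi]
  have hxi : x i ≤ min 1 (r {i}) := le_min (hx1 i) (by simpa using hxS {i})
  set t := min 1 (r {i}) / 2 with ht
  have ht0 : 0 < t := by linarith
  have ht1 : t + t ≤ 1 := by linarith [min_le_left 1 (r {i})]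
  have hmem : ∀ s, 0 ≤ s → s ≤ 1 → Function.update (0 : Fin n → ℝ) i s ∈ cube n := fun s h0 h1 =>
    update_mem_cube zero_mem_cube i ⟨h0, h1⟩
  have hle : ∀ s s', s ≤ s' →
      Function.update (0 : Fin n → ℝ) i s ≤ Function.update (0 : Fin n → ℝ) i s' := fun s s' h =>
    update_le_update_iff.2 ⟨h, fun _ _ => le_rfl⟩
  have hft : f (Function.update 0 i t) = 0 := h (some i)
  have hsum : ∀ s s' (g : Fin n → ℝ), ∑ j, (Function.update (0 : Fin n → ℝ) i s' j -
      Function.update (0 : Fin n → ℝ) i s j) * g j = (s' - s) * g i := by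
    intro s s' g
    rw [Finset.sum_eq_single i]
    · simp
    · intro j _ hj
      simp [hj]
    · simp
  -- On the segment from 0 to `2 * t` in direction `i`, `f` is concave, nonnegative and zero at the
  -- interior point `t`. The value at `2 * t` forces a nonnegative slope at `t`, so `f` is at most 0
  -- before `t` and its slope at 0 is not positive. A probe at the end of the segment would not
  -- suffice.
  have h2 := hf.sub_le_sum_grad (hmem t ht0.le (by linarith)) (hmem (t + t) (by linarith) ht1)
    (hle _ _ (by linarith))
  rw [hsum, hft] at h2
  have h3 := hf.nonneg _ (hmem (t + t) (by linarith) ht1)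
  have hg : 0 ≤ grad f (Function.update 0 i t) i := by
    by_contra! hcon
    nlinarith
  have hder := tendsto_slope_right (hasDerivWithinAt_update hf.diff zero_mem_cube i) le_rfl
    zero_lt_one
  have hgrad : grad f 0 i ≤ 0 := by
    refine le_of_tendsto hder ?_
    filter_upwards [Ioo_mem_nhdsGT ht0] with δ hδ
    have h4 := hf.sum_grad_le_sub (hmem δ hδ.1.le (by linarith [hδ.2]))
      (hmem t ht0.le (by linarith)) (hle _ _ hδ.2.le)
    rw [hsum, hft] at h4
    have h5 := mul_nonneg (sub_nonneg.2 hδ.2.le) hg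
    have e : Function.update (0 : Fin n → ℝ) i ((0 : Fin n → ℝ) i) = 0 :=
      Function.update_eq_self i 0
    rw [e, h0, Pi.zero_apply, zero_add]
    exact mul_nonpos_of_nonneg_of_nonpos (inv_nonneg.2 hδ.1.le) (by linarith)
  simpa using mul_nonpos_of_nonneg_of_nonpos hi.le hgrad

/-- Exhaustive search over a grid that is fine enough for the observed values. -/
noncomputable def exhaustiveAlg (r : Finset (Fin n) → ℝ) (ε : ℝ) : Algorithm n :=
  Algorithm.query ⟨0, zero_mem_cube⟩ fun b =>
    Algorithm.round (Fintype.card (Option (Fin n)))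
      (fun j => toCube (probe r ((Fintype.equivFin _).symm j))) fun a =>
        searchAlg r (grid n
          (⌈(n + 1) * (n * gradBound b.2) / (ε * ∑ j, (a j).1)⌉₊ + 1))

theorem IsObjective.exhaustiveAlg_spec (hf : IsObjective f) (hr : IsPolymatroidRank r) {ε : ℝ}
    (hε : 0 < ε) {xopt : Fin n → ℝ} (hopt : xopt ∈ feasible r)
    (hmax : IsMaxOn f (feasible r) xopt) :
    (exhaustiveAlg r ε).result f ∈ feasible r ∧
      (1 - ε) * f xopt ≤ f ((exhaustiveAlg r ε).result f) := by
  have hoc := feasible_subset_cube hopt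
  set s := ∑ o, f (probe r o) with hs
  set G := gradBound (grad f 0) with hG
  set D := ⌈(n + 1) * (n * G) / (ε * s)⌉₊ + 1 with hD
  have hG0 : 0 ≤ G := gradBound_nonneg _
  have e : (exhaustiveAlg r ε).result f = (searchAlg r (grid n D)).result f := by
    simp only [exhaustiveAlg, Algorithm.query, Algorithm.result]
    have e1 : ∑ j : Fin (Fintype.card (Option (Fin n))),
        (oracle f (toCube (probe r ((Fintype.equivFin (Option (Fin n))).symm j)))).1 = s := by
      rw [hs, ← Equiv.sum_comp (Fintype.equivFin (Option (Fin n))).symm]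
      refine Finset.sum_congr rfl fun j _ => ?_
      rw [oracle_toCube (feasible_subset_cube (probe_mem_feasible hr _))]
    rw [e1]
    rfl
  rw [e]
  obtain ⟨j, hj0, hjx, hjD⟩ := exists_grid_near (D := D) (Nat.succ_pos _) hoc
  have hjf := mem_feasible_of_le hopt hj0 hjx
  have hjc := feasible_subset_cube hjf
  obtain ⟨h1, h2⟩ := searchAlg_spec (f := f) hjf
  refine ⟨h1, le_trans ?_ h2⟩
  have hpr : ∀ o, 0 ≤ f (probe r o) := fun o =>
    hf.nonneg _ (feasible_subset_cube (probe_mem_feasible hr o))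
  have hs0 : 0 ≤ s := Finset.sum_nonneg fun o _ => hpr o
  -- If all probes vanish, the quotient in `D` is 0 by convention and `D = 1`; the optimum is then 0
  -- and any feasible point will do.
  rcases hs0.eq_or_lt with hs1 | hs1
  · have hz : ∀ o, f (probe r o) = 0 := fun o =>
      (Finset.sum_eq_zero_iff_of_nonneg fun o _ => hpr o).1 hs1.symm o (Finset.mem_univ o)
    have h3 := hf.le_zero_of_probe hz hopt
    have h4 : f xopt = 0 := le_antisymm h3 (hf.nonneg _ hoc)
    rw [h4, mul_zero]
    exact hf.nonneg _ hjc
  -- The observable `s` bounds the unknown optimum from below up to a factor `n + 1`, so the grid is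
  -- fine enough: rounding the optimum down loses at most `n * G / D ≤ ε * f xopt`.
  · have hsO : s ≤ (n + 1) * f xopt := by
      calc s ≤ ∑ _o : Option (Fin n), f xopt :=
            Finset.sum_le_sum fun o _ => hmax (probe_mem_feasible hr o)
        _ = (n + 1) * f xopt := by simp
    have hDpos : (0 : ℝ) < D := by
      rw [hD]
      positivity
    have hDle : (n + 1) * (n * G) / (ε * s) ≤ D := by
      rw [hD]
      push_cast
      linarith [Nat.le_ceil ((n + 1) * (n * G) / (ε * s))]
    have h3 : n * G * (1 / D) ≤ ε * f xopt := by
      rw [div_le_iff₀ (mul_pos hε hs1)] at hDle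
      have h4 : (D : ℝ) * (ε * s) ≤ D * (ε * ((n + 1) * f xopt)) := by gcongr
      have h5 : ((n : ℝ) + 1) * (n * G) ≤ (n + 1) * (D * (ε * f xopt)) := by linarith
      have h6 := le_of_mul_le_mul_left h5 (by positivity)
      rw [mul_one_div, div_le_iff₀ hDpos]
      linarith
    have h4 := hf.sub_le_sum_grad hjc hoc hjx
    have h5 : ∑ i, (xopt i - grid n D j i) * grad f (grid n D j) i ≤ ∑ _i : Fin n, 1 / D * G := by
      refine Finset.sum_le_sum fun i _ => ?_
      have hg : grad f (grid n D j) i ≤ G :=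
        (hf.grad_anti zero_mem_cube hjc hjc.1 i).trans (le_gradBound _ i)
      exact (mul_le_mul_of_nonneg_left hg (sub_nonneg.2 (hjx i))).trans
        (mul_le_mul_of_nonneg_right (hjD i) hG0)
    simp only [Finset.sum_const, Finset.card_univ, Fintype.card_fin, nsmul_eq_mul] at h5
    linarith

/-! ### The gradient of a multilinear extension. -/

theorem differentiable_multilinearExt (g : Finset (Fin n) → ℝ) :
    Differentiable ℝ (multilinearExt g) := by
  unfold multilinearExt
  fun_prop

/-- The probability of the set `S` when every element `j ≠ i` is chosen independently with
probability `x j`. -/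
def setWeight (x : Fin n → ℝ) (i : Fin n) (S : Finset (Fin n)) : ℝ :=
  (∏ j ∈ S, x j) * ∏ j ∈ Finset.univ.erase i \ S, (1 - x j)

theorem setWeight_nonneg {x : Fin n → ℝ} (hx : x ∈ cube n) (i : Fin n) (S : Finset (Fin n)) :
    0 ≤ setWeight x i S :=
  mul_nonneg (Finset.prod_nonneg fun j _ => (mem_cube_iff.1 hx j).1)
    (Finset.prod_nonneg fun j _ => sub_nonneg.2 (mem_cube_iff.1 hx j).2)

theorem sum_setWeight (x : Fin n → ℝ) (i : Fin n) :
    ∑ S ∈ (Finset.univ.erase i).powerset, setWeight x i S = 1 := by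
  simp only [setWeight]
  rw [← Finset.prod_add]
  simp

/-- Splitting the sets by membership of `i` shows that the extension is affine in each coordinate,
with slope the expected marginal value of `i`. -/
theorem multilinearExt_update (g : Finset (Fin n) → ℝ) (x : Fin n → ℝ) (i : Fin n) (t : ℝ) :
    multilinearExt g (Function.update x i t) =
      (1 - t) * ∑ S ∈ (Finset.univ.erase i).powerset, g S * setWeight x i S +
        t * ∑ S ∈ (Finset.univ.erase i).powerset, g (insert i S) * setWeight x i S := by
  have hu : (Finset.univ : Finset (Finset (Fin n))) =
      (insert i (Finset.univ.erase i)).powerset := by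
    rw [Finset.insert_erase (Finset.mem_univ i), Finset.powerset_univ]
  rw [multilinearExt, hu, Finset.sum_powerset_insert (Finset.notMem_erase i _), Finset.mul_sum,
    Finset.mul_sum]
  have hprod : ∀ S : Finset (Fin n), i ∉ S →
      ∏ j ∈ S, Function.update x i t j = ∏ j ∈ S, x j := fun S hS =>
    Finset.prod_congr rfl fun j hj => by
      rw [Function.update_of_ne]
      rintro rfl
      exact hS hj
  have hprod' : ∀ S : Finset (Fin n), i ∉ S →
      ∏ j ∈ S, (1 - Function.update x i t j) = ∏ j ∈ S, (1 - x j) := fun S hS =>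
    Finset.prod_congr rfl fun j hj => by
      rw [Function.update_of_ne]
      rintro rfl
      exact hS hj
  congr 1
  · refine Finset.sum_congr rfl fun S hS => ?_
    have hi : i ∉ S := fun h => Finset.notMem_erase i _ (Finset.mem_powerset.1 hS h)
    have hc : Sᶜ = insert i (Finset.univ.erase i \ S) := by
      ext j
      simp only [Finset.mem_compl, Finset.mem_insert, Finset.mem_sdiff, Finset.mem_erase,
        Finset.mem_univ, and_true]
      grind
    have hi' : i ∉ Finset.univ.erase i \ S := by simp
    rw [hc, Finset.prod_insert hi', hprod S hi, hprod' _ hi', Function.update_self, setWeight]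
    ring
  · refine Finset.sum_congr rfl fun S hS => ?_
    have hi : i ∉ S := fun h => Finset.notMem_erase i _ (Finset.mem_powerset.1 hS h)
    have hc : (insert i S)ᶜ = Finset.univ.erase i \ S := by
      ext j
      simp only [Finset.mem_compl, Finset.mem_insert, Finset.mem_sdiff, Finset.mem_erase,
        Finset.mem_univ, and_true]
      grind
    have hi' : i ∉ Finset.univ.erase i \ S := by simp
    rw [hc, Finset.prod_insert hi, hprod S hi, hprod' _ hi', Function.update_self, setWeight]
    ring

theorem grad_multilinearExt (g : Finset (Fin n) → ℝ) {x : Fin n → ℝ} (hx : x ∈ cube n)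
    (i : Fin n) : grad (multilinearExt g) x i =
      ∑ S ∈ (Finset.univ.erase i).powerset, (g (insert i S) - g S) * setWeight x i S := by
  have h1 := hasDerivWithinAt_update (differentiable_multilinearExt g).differentiableOn hx i
  set A := ∑ S ∈ (Finset.univ.erase i).powerset, g S * setWeight x i S
  set B := ∑ S ∈ (Finset.univ.erase i).powerset, g (insert i S) * setWeight x i S
  have h2 : HasDerivWithinAt (fun t => multilinearExt g (Function.update x i t)) (B - A)
      (Set.Icc 0 1) (x i) := by
    simp only [multilinearExt_update]
    have h3 : HasDerivAt (fun t : ℝ => (1 - t) * A + t * B) (-1 * A + 1 * B) (x i) :=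
      (((hasDerivAt_id (x i)).const_sub 1).mul_const A).add ((hasDerivAt_id (x i)).mul_const B)
    have e : B - A = -1 * A + 1 * B := by ring
    rw [e]
    exact h3.hasDerivWithinAt
  have h3 := (uniqueDiffOn_Icc (zero_lt_one (α := ℝ)) (x i) (mem_cube_iff.1 hx i)).eq_deriv _ h1 h2
  rw [h3, ← Finset.sum_sub_distrib]
  exact Finset.sum_congr rfl fun S _ => by ring

theorem multilinearExt_single (g : Finset (Fin n) → ℝ) (i : Fin n) :
    multilinearExt g (Pi.single i 1) = g {i} := by
  rw [multilinearExt, Finset.sum_eq_single {i}]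
  · rw [Finset.prod_singleton, Finset.prod_eq_one]
    · simp
    · intro j hj
      have : j ≠ i := by simpa using hj
      simp [this]
  · intro S _ hS
    by_cases hi : i ∈ S
    · obtain ⟨j, hj, hji⟩ : ∃ j ∈ S, j ≠ i := by
        by_contra! hcon
        exact hS (Finset.eq_singleton_iff_unique_mem.2 ⟨hi, hcon⟩)
      rw [Finset.prod_eq_zero hj (by simp [hji])]
      simp
    · rw [Finset.prod_eq_zero (s := Sᶜ) (i := i) (by simpa using hi) (by simp)]
      simp
  · simp

/-- By submodularity and `0 ≤ g ∅`, every marginal value of `i` is at most `g {i}`. This is the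
value at the unit vector, which is feasible since `1 ≤ r {i}`. -/
theorem grad_multilinearExt_le (hr : IsPolymatroidRank r) (hloop : ∀ i, 1 ≤ r {i})
    {g : Finset (Fin n) → ℝ} (hg0 : ∀ S, 0 ≤ g S) (hg : IsSubmodular g) {xopt : Fin n → ℝ}
    (hmax : IsMaxOn (multilinearExt g) (feasible r) xopt) {x : Fin n → ℝ} (hx : x ∈ cube n)
    (i : Fin n) : grad (multilinearExt g) x i ≤ multilinearExt g xopt := by
  have hmem : Pi.single i 1 ∈ feasible r := by
    have h0 : (0 : Fin n → ℝ) ≤ Pi.single i 1 := Pi.single_nonneg.2 zero_le_one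
    refine mem_feasible_iff.2 ⟨h0, fun j => ?_, fun S => ?_⟩
    · rcases eq_or_ne j i with rfl | hj <;> simp [*]
    · rw [Finset.sum_pi_single']
      split_ifs with hi
      · exact (hloop i).trans (hr.mono _ _ (Finset.singleton_subset_iff.2 hi))
      · exact hr.nonneg S
  refine le_trans ?_ (hmax hmem)
  rw [multilinearExt_single, grad_multilinearExt g hx]
  calc ∑ S ∈ (Finset.univ.erase i).powerset, (g (insert i S) - g S) * setWeight x i S
      ≤ ∑ S ∈ (Finset.univ.erase i).powerset, g {i} * setWeight x i S := by
        refine Finset.sum_le_sum fun S hS => ?_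
        have hi : i ∉ S := fun h => Finset.notMem_erase i _ (Finset.mem_powerset.1 hS h)
        have h1 := hg ∅ S (Finset.empty_subset S) i hi
        rw [insert_empty_eq] at h1
        exact mul_le_mul_of_nonneg_right (by linarith [hg0 ∅]) (setWeight_nonneg hx i S)
    _ = g {i} := by rw [← Finset.mul_sum, sum_setWeight, mul_one]

/-! ### Choice of parameters and the round count. -/

theorem neg_log_le_two_div_sqrt {ε : ℝ} (hε : 0 < ε) : -Real.log ε ≤ 2 / √ε := by
  have hs := Real.sqrt_pos.2 hε
  have h1 := Real.log_le_sub_one_of_pos (inv_pos.2 hs)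
  rw [Real.log_inv, Real.log_sqrt hε.le, inv_eq_one_div] at h1
  have h2 : 2 / √ε = 2 * (1 / √ε) := by ring
  rw [h2]
  linarith

/-- Numbers of growth steps and of thresholds that suffice for `N` phases. -/
theorem exists_round_counts {N m : ℝ} (hN : 1 ≤ N) (hm : 2 ≤ m) : ∃ R J : ℕ,
    1 < ((2 : ℝ) ^ R - 1) * (1 / (N * m)) ∧ m * (1 - 1 / N) ^ J ≤ 1 / N ∧
    (J : ℝ) ≤ 2 * (N * Real.log (2 * (N * m))) ∧ (R : ℝ) ≤ 3 * Real.log (2 * (N * m)) := by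
  have hN0 : 0 < N := by linarith
  have hM : 2 ≤ N * m := by nlinarith
  set L := Real.log (2 * (N * m)) with hL
  have hexp : Real.exp L = 2 * (N * m) := Real.exp_log (by linarith)
  have hL1 : 1 ≤ L := by
    rw [hL, Real.le_log_iff_exp_le (by linarith)]
    linarith [Real.exp_one_lt_d9]
  -- Since `2 * log 2 > 1`, doubling `2 * L` times exceeds `exp L`; a factor `1 - 1 / N` applied `N
  -- * L` times falls below `exp (-L)`.
  refine ⟨⌈2 * L⌉₊, ⌈N * L⌉₊, ?_, ?_, ?_, ?_⟩
  · have h1 : 2 * (N * m) ≤ (2 : ℝ) ^ ⌈2 * L⌉₊ := by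
      have e : (2 : ℝ) ^ ⌈2 * L⌉₊ = Real.exp (⌈2 * L⌉₊ * Real.log 2) := by
        rw [Real.exp_nat_mul, Real.exp_log two_pos]
      rw [e, ← hexp, Real.exp_le_exp]
      have h1 := Real.log_two_gt_d9
      have h2 := Nat.le_ceil (2 * L)
      nlinarith
    rw [mul_one_div, lt_div_iff₀ (by linarith)]
    linarith
  · have hη1 : 1 / N ≤ 1 := by rwa [div_le_one hN0]
    have h1 : (1 - 1 / N) ^ ⌈N * L⌉₊ ≤ 1 / (2 * (N * m)) := by
      calc (1 - 1 / N) ^ ⌈N * L⌉₊ ≤ Real.exp (-(1 / N)) ^ ⌈N * L⌉₊ :=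
            pow_le_pow_left₀ (by linarith) (by linarith [Real.add_one_le_exp (-(1 / N))]) _
        _ ≤ Real.exp (-L) := by
            rw [← Real.exp_nat_mul, Real.exp_le_exp]
            have h2 := mul_le_mul_of_nonneg_right (Nat.le_ceil (N * L))
              (by positivity : 0 ≤ 1 / N)
            have h3 : N * L * (1 / N) = L := by field_simp
            linarith
        _ = 1 / (2 * (N * m)) := by rw [Real.exp_neg, hexp, one_div]
    calc m * (1 - 1 / N) ^ ⌈N * L⌉₊ ≤ m * (1 / (2 * (N * m))) :=
          mul_le_mul_of_nonneg_left h1 (by linarith)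
      _ = 1 / (2 * N) := by field_simp
      _ ≤ 1 / N := one_div_le_one_div_of_le hN0 (by linarith)
  · have h1 := Nat.ceil_lt_add_one (by positivity : 0 ≤ N * L)
    nlinarith
  · have h1 := Nat.ceil_lt_add_one (by positivity : 0 ≤ 2 * L)
    linarith

/-- The root is chosen because the round count contains the logarithm squared: this costs one extra
factor 1/ε. The bound `1 / 2 ≤ l` absorbs additive constants. -/
theorem log_le_of_le_pow {A l ε M : ℝ} {k : ℕ} {c n : ℝ} (hε : 0 < ε) (hε1 : ε < 1)
    (hn : 0 < n) (hl : l = Real.log n) (hl2 : 1 / 2 ≤ l) (hc : 0 < c) (hA : A = Real.log c)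
    (hA0 : 0 ≤ A) (hM : 0 < M) (h : M ≤ c * (n / ε) ^ k) :
    Real.log M ≤ (2 * A + 5 * k) * (l / √ε) := by
  have hs0 := Real.sqrt_pos.2 hε
  have hs1 : √ε ≤ 1 := Real.sqrt_le_one.2 hε1.le
  have h2 : Real.log M ≤ A + k * (l - Real.log ε) := by
    refine (Real.log_le_log hM h).trans (le_of_eq ?_)
    rw [Real.log_mul hc.ne' (by positivity), Real.log_pow, Real.log_div hn.ne' hε.ne', hA, hl]
  have h3 := neg_log_le_two_div_sqrt hε
  have hl1 : l ≤ l / √ε := by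
    rw [le_div_iff₀ hs0]
    nlinarith
  have hl3 : 2 / √ε ≤ 4 * (l / √ε) := by
    rw [← mul_div_assoc]
    exact div_le_div_of_nonneg_right (by linarith) hs0.le
  have h4 : A ≤ 2 * A * (l / √ε) := by nlinarith
  have h5 : (k : ℝ) * (l - Real.log ε) ≤ k * (5 * (l / √ε)) :=
    mul_le_mul_of_nonneg_left (by linarith) (Nat.cast_nonneg k)
  linarith

/-- Parameters of the algorithm, with a bound for the resulting number of rounds. -/
theorem exists_parameters (c : ℝ) (k : ℕ) : ∃ C : ℝ, 0 ≤ C ∧ ∀ n : ℕ, 2 ≤ n → ∀ ε : ℝ, 0 < ε →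
    ε < 1 → ∃ (N R J : ℕ) (η τ K : ℝ), (N : ℝ) * η = 1 ∧ 0 < η ∧ 32 * η ≤ ε ∧ 0 ≤ τ ∧ τ ≤ 1 ∧
      1 < ((2 : ℝ) ^ R - 1) * τ ∧ 0 ≤ K ∧ n * (τ * K) ≤ η ∧ n * (K * (1 - η) ^ J) ≤ η ∧
      16 * (n * (max c 1 * ((n : ℝ) / ε) ^ k)) ≤ K ∧
      ((N * (J * R) + 2 : ℕ) : ℝ) ≤ C * Real.log n ^ 2 / ε ^ 3 := by
  have hc1 : 1 ≤ max c 1 := le_max_right c 1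
  generalize max c 1 = c' at hc1 ⊢
  have hA0 : 0 ≤ Real.log (1056 * c') := Real.log_nonneg (by linarith)
  obtain ⟨B, hB⟩ : ∃ B : ℝ, B = 2 * Real.log (1056 * c') + 5 * ((k + 2 : ℕ) : ℝ) := ⟨_, rfl⟩
  have hB0 : 0 ≤ B := by rw [hB]; positivity
  -- Here `6534 = 6 * 33 ^ 2` comes from `N ≤ 33 / ε` and `J * R ≤ 6 * N * L ^ 2`; the 8 pays for
  -- the two queries outside the phases, as `log n ≥ 1 / 2`. In `B`, `1056 = 2 * 33 * 16`.
  refine ⟨6534 * B ^ 2 + 8, by positivity, fun n hn ε hε hε1 => ?_⟩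
  have hn2 : (2 : ℝ) ≤ n := by exact_mod_cast hn
  have hnε : 1 ≤ (n : ℝ) / ε := by
    rw [le_div_iff₀ hε]
    linarith
  obtain ⟨K, hK⟩ : ∃ K : ℝ, K = 16 * (n * (c' * ((n : ℝ) / ε) ^ k)) := ⟨_, rfl⟩
  have hpow : 1 ≤ ((n : ℝ) / ε) ^ k := one_le_pow₀ hnε
  have hK1 : 1 ≤ K := by
    have h1 : 1 ≤ c' * ((n : ℝ) / ε) ^ k := one_le_mul_of_one_le_of_one_le hc1 hpow
    nlinarith
  obtain ⟨N, hN⟩ : ∃ N : ℕ, N = ⌈32 / ε⌉₊ := ⟨_, rfl⟩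
  have hNge : 32 ≤ N * ε := by
    rw [← div_le_iff₀ hε, hN]
    exact Nat.le_ceil _
  have hN1 : 1 ≤ (N : ℝ) := by nlinarith
  have hNle : (N : ℝ) ≤ 33 / ε := by
    have h1 : (N : ℝ) < 32 / ε + 1 := hN ▸ Nat.ceil_lt_add_one (by positivity)
    have h2 : 1 ≤ 1 / ε := by
      rw [le_div_iff₀ hε]
      linarith
    have h3 : 33 / ε = 32 / ε + 1 / ε := by ring
    linarith
  have hN0 : (0 : ℝ) < N := by linarith
  have hnK : 2 ≤ n * K := by nlinarith
  have hM : 1 ≤ N * (n * K) := by nlinarith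
  obtain ⟨R, J, hR, hJ, hJle, hRle⟩ := exists_round_counts hN1 hnK
  have hl : 1 / 2 ≤ Real.log n := by
    have h1 := Real.log_two_gt_d9
    have h2 := Real.log_le_log two_pos hn2
    linarith
  have hlog : Real.log (2 * (N * (n * K))) ≤ B * (Real.log n / √ε) := by
    rw [hB]
    refine log_le_of_le_pow hε hε1 (by linarith) rfl hl (by linarith) rfl hA0 (by linarith) ?_
    calc 2 * (N * (n * K)) ≤ 2 * (33 / ε * (n * K)) := by
          have := mul_le_mul_of_nonneg_right hNle (by linarith : 0 ≤ n * K)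
          linarith
      _ = 1056 * c' * ((n : ℝ) / ε) ^ k * (n ^ 2 / ε) := by rw [hK]; ring
      _ ≤ 1056 * c' * ((n : ℝ) / ε) ^ k * (n / ε) ^ 2 := by
          refine mul_le_mul_of_nonneg_left ?_ (by positivity)
          rw [div_pow]
          exact div_le_div_of_nonneg_left (by positivity) (by positivity) (by nlinarith)
      _ = 1056 * c' * ((n : ℝ) / ε) ^ (k + 2) := by ring
  have hL0 : 0 ≤ Real.log (2 * (N * (n * K))) := Real.log_nonneg (by linarith)
  generalize Real.log (2 * (N * (n * K))) = L at hlog hJle hRle hL0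
  refine ⟨N, R, J, 1 / N, 1 / (N * (n * K)), K, mul_one_div_cancel hN0.ne', by positivity, ?_,
    by positivity, ?_, hR, by linarith, ?_, by rw [← mul_assoc]; exact hJ, hK.ge, ?_⟩
  · rw [mul_one_div, div_le_iff₀ hN0]
    linarith
  · rw [div_le_one (by linarith)]
    exact hM
  · have hK0 : K ≠ 0 := by linarith
    refine le_of_eq ?_
    field_simp
  · have h1 : (N : ℝ) * (J * R) ≤ N * (2 * (N * L) * (3 * L)) := by gcongr
    have h2 : (N : ℝ) * (2 * (N * L) * (3 * L)) = 6 * N ^ 2 * L ^ 2 := by ring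
    have h3 : 6 * (N : ℝ) ^ 2 * L ^ 2 ≤ 6 * (33 / ε) ^ 2 * (B * (Real.log n / √ε)) ^ 2 := by
      gcongr
    have h4 : 6 * (33 / ε) ^ 2 * (B * (Real.log n / √ε)) ^ 2
        = 6534 * B ^ 2 * Real.log n ^ 2 / ε ^ 3 := by
      rw [mul_pow, div_pow, div_pow, Real.sq_sqrt hε.le]
      field_simp
      ring
    have h5 : 2 ≤ 8 * Real.log n ^ 2 / ε ^ 3 := by
      rw [le_div_iff₀ (by positivity)]
      have : ε ^ 3 ≤ 1 := pow_le_one₀ hε.le hε1.le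
      nlinarith
    have h6 : (6534 * B ^ 2 + 8) * Real.log n ^ 2 / ε ^ 3
        = 6534 * B ^ 2 * Real.log n ^ 2 / ε ^ 3 + 8 * Real.log n ^ 2 / ε ^ 3 := by ring
    push_cast
    rw [h6]
    linarith

/-! ### The certified algorithm and the proof of its guarantees. -/

open Classical in
/-- The greedy algorithm, followed by exhaustive search if its output does not certify that the
gradient is small compared to the optimum. -/
noncomputable def certifiedAlg (r : Finset (Fin n) → ℝ) (ε η τ K : ℝ) (R J N : ℕ) : Algorithm n :=
  Algorithm.query ⟨0, zero_mem_cube⟩ fun a =>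
    (greedyAlg r η τ (gradBound a.2) R J N).bind fun x =>
      Algorithm.query (toCube x) fun b =>
        if x ∈ feasible r ∧ gradBound a.2 ≤ K * b.1 then Algorithm.output x
        else exhaustiveAlg r ε

theorem certifiedAlg_eq_of_certified {ε η τ K : ℝ} {R J N : ℕ} {x : Fin n → ℝ}
    (hx : (greedyAlg r η τ (gradBound (grad f 0)) R J N).result f = x) (hxf : x ∈ feasible r)
    (hK : gradBound (grad f 0) ≤ K * f x) :
    (certifiedAlg r ε η τ K R J N).result f = x ∧
    (certifiedAlg r ε η τ K R J N).rounds f = N * (J * R) + 2 ∧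
    (certifiedAlg r ε η τ K R J N).evaluations f = N * (J * R) + 2 := by
  have ho : oracle f (toCube x) = (f x, grad f x) := oracle_toCube (feasible_subset_cube hxf)
  have h : x ∈ feasible r ∧ gradBound (oracle f ⟨0, zero_mem_cube⟩).2 ≤
      K * (oracle f (toCube x)).1 := ⟨hxf, by rw [ho]; exact hK⟩
  have hx' : (greedyAlg r η τ (gradBound (oracle f ⟨0, zero_mem_cube⟩).2) R J N).result f = x := hx
  simp only [certifiedAlg, Algorithm.query, Algorithm.result, Algorithm.rounds,
    Algorithm.evaluations, Algorithm.result_bind, Algorithm.rounds_bind,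
    Algorithm.evaluations_bind, rounds_greedyAlg, evaluations_greedyAlg]
  rw [hx', if_pos h]
  exact ⟨rfl, rfl, rfl⟩

theorem certifiedAlg_result_of_not_certified {ε η τ K : ℝ} {R J N : ℕ} {x : Fin n → ℝ}
    (hx : (greedyAlg r η τ (gradBound (grad f 0)) R J N).result f = x)
    (h : ¬ (x ∈ feasible r ∧ gradBound (grad f 0) ≤ K * f x)) :
    (certifiedAlg r ε η τ K R J N).result f = (exhaustiveAlg r ε).result f := by
  have h' : ¬ (x ∈ feasible r ∧ gradBound (oracle f ⟨0, zero_mem_cube⟩).2 ≤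
      K * (oracle f (toCube x)).1) := fun hcon => h ⟨hcon.1, by
    have := hcon.2
    rwa [oracle_toCube (feasible_subset_cube hcon.1)] at this⟩
  have hx' : (greedyAlg r η τ (gradBound (oracle f ⟨0, zero_mem_cube⟩).2) R J N).result f = x := hx
  simp only [certifiedAlg, Algorithm.query, Algorithm.result, Algorithm.result_bind]
  rw [hx', if_neg h']

theorem exists_algorithm (c : ℝ) (k : ℕ) : ∃ C : ℝ, ∀ n : ℕ, 2 ≤ n → ∀ ε : ℝ, 0 < ε →
    ∀ r : Finset (Fin n) → ℝ, IsPolymatroidRank r → ∃ A : Algorithm n,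
      ∀ f : (Fin n → ℝ) → ℝ, IsObjective f →
        ∀ xopt ∈ feasible r, IsMaxOn f (feasible r) xopt →
          A.result f ∈ feasible r ∧
          (MonotoneOn f (cube n) → (1 - 1 / Real.exp 1 - ε) * f xopt ≤ f (A.result f)) ∧
          (1 / Real.exp 1 - ε) * f xopt ≤ f (A.result f) ∧
          ((∀ x ∈ cube n, ∀ i : Fin n, grad f x i ≤ c * ((n : ℝ) / ε) ^ k * f xopt) →
            (A.rounds f : ℝ) ≤ C * Real.log n ^ 2 / ε ^ 3 ∧
            (A.evaluations f : ℝ) ≤ C * Real.log n ^ 2 / ε ^ 3) := by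
  obtain ⟨C, hC, hpar⟩ := exists_parameters c k
  have he0 : 0 < 1 / Real.exp 1 := by positivity
  have he : 1 / 3 ≤ 1 / Real.exp 1 :=
    one_div_le_one_div_of_le (Real.exp_pos 1) (by linarith [Real.exp_one_lt_d9])
  have he1 : 1 / Real.exp 1 ≤ 1 / 2 :=
    one_div_le_one_div_of_le two_pos (by linarith [Real.exp_one_gt_d9])
  refine ⟨C, fun n hn ε hε r hr => ?_⟩
  -- For `ε ≥ 1` both guarantees are nonpositive, and 0 is returned without any query.
  rcases le_or_gt 1 ε with hε1 | hε1
  · refine ⟨Algorithm.output 0, fun f hf xopt hopt hmax => ?_⟩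
    have hO := hf.nonneg _ (feasible_subset_cube hopt)
    have h0 := hf.nonneg _ (zero_mem_cube (n := n))
    simp only [Algorithm.result, Algorithm.rounds, Algorithm.evaluations, Nat.cast_zero]
    have hCpos : 0 ≤ C * Real.log n ^ 2 / ε ^ 3 := by positivity
    exact ⟨zero_mem_feasible hr,
      fun _ => (mul_nonpos_of_nonpos_of_nonneg (by linarith) hO).trans h0,
      (mul_nonpos_of_nonpos_of_nonneg (by linarith) hO).trans h0, fun _ => ⟨hCpos, hCpos⟩⟩
  obtain ⟨N, R, J, η, τ, K, hN, hη0, hη, hτ0, hτ1, hR, hK0, hτK, hJK, hcK, hrounds⟩ :=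
    hpar n hn ε hε hε1
  refine ⟨certifiedAlg r ε η τ K R J N, fun f hf xopt hopt hmax => ?_⟩
  have hO := hf.nonneg _ (feasible_subset_cube hopt)
  set G := gradBound (grad f 0) with hG
  have hspec : G ≤ K * f xopt → _ := fun hGK => IsTuned.greedy_spec (N := N) (R := R) (J := J)
    (η := η) (τ := τ) (G := G) (xopt := xopt)
    { η_pos := hη0
      η_le := by linarith
      τ_nonneg := hτ0
      τ_le := hτ1
      one_lt := hR
      G_nonneg := gradBound_nonneg _
      grad_le := le_gradBound _
      growth_le := by
        calc n * (τ * G) ≤ n * (τ * (K * f xopt)) := by gcongr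
          _ = n * (τ * K) * f xopt := by ring
          _ ≤ η * f xopt := by gcongr
      threshold_le := by
        have h1 : 0 ≤ (1 - η) ^ J := pow_nonneg (by linarith) J
        calc n * (G * (1 - η) ^ J) ≤ n * (K * f xopt * (1 - η) ^ J) := by gcongr
          _ = n * (K * (1 - η) ^ J) * f xopt := by ring
          _ ≤ η * f xopt := by gcongr } hf hr hopt hN
  set x := (greedyAlg r η τ G R J N).result f with hx
  -- A passed certificate shows after the fact that the parameters were tuned.
  have hvalue : (x ∈ feasible r ∧ G ≤ K * f x) → G ≤ K * f xopt := fun h =>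
    h.2.trans (mul_le_mul_of_nonneg_left (hmax h.1) hK0)
  have hcert : (∀ x ∈ cube n, ∀ i : Fin n, grad f x i ≤ c * ((n : ℝ) / ε) ^ k * f xopt) →
      x ∈ feasible r ∧ G ≤ K * f x := by
    intro hgrad
    have hpow : 0 ≤ ((n : ℝ) / ε) ^ k := by positivity
    have hnn : 0 ≤ max c 1 * ((n : ℝ) / ε) ^ k * f xopt :=
      mul_nonneg (mul_nonneg (zero_le_one.trans (le_max_right c 1)) hpow) hO
    have h1 : G ≤ n * (max c 1 * ((n : ℝ) / ε) ^ k * f xopt) := by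
      calc G ≤ ∑ _i : Fin n, max c 1 * ((n : ℝ) / ε) ^ k * f xopt := by
            refine Finset.sum_le_sum fun i _ => max_le hnn ((hgrad 0 zero_mem_cube i).trans ?_)
            gcongr
            exact le_max_left c 1
        _ = _ := by simp
    have h2 : 16 * G ≤ K * f xopt := by
      have := mul_le_mul_of_nonneg_right hcK hO
      linarith
    have hG0 : 0 ≤ G := gradBound_nonneg _
    obtain ⟨h3, -, h4⟩ := hspec (by linarith)
    -- `1 / e - 8 * η ≥ 1 / 3 - 1 / 4`, which exceeds `1 / 16`; the factor 16 in `K` is the matching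
    -- slack.
    have h5 : 1 / 16 * f xopt ≤ f x := le_trans (mul_le_mul_of_nonneg_right (by linarith) hO) h4
    have h6 := mul_le_mul_of_nonneg_left h5 hK0
    exact ⟨h3, by linarith⟩
  by_cases h : x ∈ feasible r ∧ G ≤ K * f x
  · obtain ⟨e1, e2, e3⟩ := certifiedAlg_eq_of_certified (ε := ε) hx.symm h.1 h.2
    obtain ⟨h1, h2, h3⟩ := hspec (hvalue h)
    rw [e1, e2, e3]
    exact ⟨h1, fun hm => (mul_le_mul_of_nonneg_right (by linarith) hO).trans (h2 hm),
      (mul_le_mul_of_nonneg_right (by linarith) hO).trans h3, fun _ => ⟨hrounds, hrounds⟩⟩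
  · rw [certifiedAlg_result_of_not_certified hx.symm h]
    obtain ⟨h1, h2⟩ := hf.exhaustiveAlg_spec hr hε hopt hmax
    exact ⟨h1, fun _ => (mul_le_mul_of_nonneg_right (by linarith) hO).trans h2,
      (mul_le_mul_of_nonneg_right (by linarith) hO).trans h2, fun hg => absurd (hcert hg) h⟩

end DRMax

theorem theorem1 :
    (∀ (c : ℝ) (k : ℕ), ∃ C : ℝ, ∀ n : ℕ, 2 ≤ n → ∀ ε : ℝ, 0 < ε →
      ∀ r : Finset (Fin n) → ℝ, DRMax.IsPolymatroidRank r →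
      ∃ A : DRMax.Algorithm n,
        ∀ f : (Fin n → ℝ) → ℝ,
          (∀ x ∈ DRMax.cube n, 0 ≤ f x) →
          DifferentiableOn ℝ f (DRMax.cube n) →
          DRMax.IsDRSubmodular f →
          ∀ xopt ∈ DRMax.feasible r, IsMaxOn f (DRMax.feasible r) xopt →
            A.result f ∈ DRMax.feasible r ∧
            (MonotoneOn f (DRMax.cube n) →
              (1 - 1 / Real.exp 1 - ε) * f xopt ≤ f (A.result f)) ∧
            (1 / Real.exp 1 - ε) * f xopt ≤ f (A.result f) ∧
            ((∀ x ∈ DRMax.cube n, ∀ i : Fin n,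
                DRMax.grad f x i ≤ c * ((n : ℝ) / ε) ^ k * f xopt) →
              (A.rounds f : ℝ) ≤ C * Real.log n ^ 2 / ε ^ 3 ∧
              (A.evaluations f : ℝ) ≤ C * Real.log n ^ 2 / ε ^ 3)) ∧
    (∀ (n : ℕ) (r : Finset (Fin n) → ℝ), DRMax.IsPolymatroidRank r → (∀ i, 1 ≤ r {i}) →
      ∀ g : Finset (Fin n) → ℝ, (∀ S, 0 ≤ g S) → DRMax.IsSubmodular g →
        ∀ xopt ∈ DRMax.feasible r,
          IsMaxOn (DRMax.multilinearExt g) (DRMax.feasible r) xopt →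
            ∀ x ∈ DRMax.cube n, ∀ i : Fin n,
              DRMax.grad (DRMax.multilinearExt g) x i ≤ DRMax.multilinearExt g xopt) := by
  refine ⟨fun c k => ?_, fun n r hr hloop g hg0 hg xopt _ hmax x hx i =>
    DRMax.grad_multilinearExt_le hr hloop hg0 hg hmax hx i⟩
  obtain ⟨C, hC⟩ := DRMax.exists_algorithm c k
  refine ⟨C, fun n hn ε hε r hr => ?_⟩
  obtain ⟨A, hA⟩ := hC n hn ε hε r hr
  exact ⟨A, fun f h0 hd hdr => hA f ⟨h0, hd, hdr⟩⟩
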